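/- **Setting.** Let $\Bbbk$ be an algebraically closed field. *The category.* Let $\mathcal C$ be a $\Bbbk$-linear strict monoidal category whose objects are the natural numbers $m\in\mathbb N=\{0,1,2,\dots\}$ ($m$ is the $m$-th tensor power of the generating object $1$, and $0$ is the unit object), with morphisms $\mathrm{cap}:2\to 0$, $\mathrm{cup}:0\to 2$ and $\mathrm{dot}:1\to 1$. Write $1_m$ for the identity of $m$. Assume the zig-zag relations $(1_1\otimes \mathrm{cap})(\mathrm{cup}\otimes 1_1)=1_1=(\mathrm{cap}\otimes 1_1)(1_1\otimes \mathrm{cup})$, and one of the following: - (first kind) $\mathrm{cap}\,(\mathrm{dot}\otimes 1_1)=-\mathrm{cap}\,(1_1\otimes \mathrm{dot})$; - (second kind) $\mathrm{dot}$ is invertible and $\mathrm{cap}\,(\mathrm{dot}\otimes 1_1)=\mathrm{cap}\,(1_1\otimes \mathrm{dot}^{-1})$. For $i\in\Bbbk$ put $i^\sharp=-i$ in the first kind, and for $i\in\Bbbk^\times$ put $i^\sharp=i^{-1}$ in the second kind. Let $K$ be a right tensor ideal of $\mathcal C$, and suppose that all morphism spaces of $\mathcal A=\mathcal C/K$ are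 finite dimensional. Let $A=\bigoplus_{a,b\in\mathbb N}1_aA1_b$ with $1_aA1_b=\operatorname{Hom}_{\mathcal A}(b,a)$, a locally unital algebra, and let $\tau_A:A\to A$, $f\mapsto f\otimes 1_1$. An $A$-module is a left module $M$ with $M=\bigoplus_a 1_aM$; $A$-mod is the category of all of them. Order $\mathbb N$ by $i\preceq j$ iff $i=j+2s$ for some $s\in\mathbb N$. For $m\in\mathbb N$ let $A_{\preceq m}$ be the quotient of $A$ by the two-sided ideal generated by all $1_c$ with $c\not\preceq m$, let $\bar 1_m$ be the image of $1_m$, $\bar A_m=\bar 1_mA_{\preceq m}\bar 1_m$ and $\bar A^\circ=\bigoplus_m\bar A_m$. The standardization functor is $$\Delta=\bigoplus_{m\in\mathbb N}A_{\preceq m}\bar 1_m\otimes_{\bar A_m}?\;:\;\bar A^\circ\text{-mod}\to A\text{-mod}.$$ The map $\tau_A$ induces algebra homomorphisms $\bar\tau_m:\bar A_m\to\bar A_{m+1}$. Let $\bar X_{m+1}\in\bar A_{m+1}$ be the image of $1_m\otimes\mathrm{dot}$. For $i\in\Bbbk$ let $(\bar A_{m+1})_{L,i}$ and $(\bar A_{m+1})_{R,i}$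 be the generalized $i$-eigenspaces of left and right multiplication by $\bar X_{m+1}$ on $\bar A_{m+1}$; through $\bar\tau_m$ they are an $(\bar A_m,\bar A_{m+1})$-bimodule and an $(\bar A_{m+1},\bar A_m)$-bimodule, respectively. Put $$\bar E_i=\bigoplus_{m}(\bar A_{m+1})_{L,i}\otimes_{\bar A_{m+1}}?,\qquad \bar F_i=\bigoplus_m(\bar A_{m+1})_{R,i}\otimes_{\bar A_m}?,\qquad \mathbb I_0=\{i\in\Bbbk:\bar E_i\ne0\},\qquad \mathbb I_0^\sharp=\{i^\sharp: i\in\mathbb I_0\}.$$ (In the second kind $0\notin\mathbb I_0$, as $\bar X_{m+1}$ is invertible.) **Assumptions.** 1. $A$ has a weakly triangular decomposition with respect to $\preceq$: there are subspaces $A^-=\bigoplus_{a,b}1_aA^-1_b$, $A^\circ=\bigoplus_a1_aA^\circ1_a$ and $A^+=\bigoplus_{a,b}1_aA^+1_b$ such that $1_aA^-1_b=0=1_bA^+1_a$ unless $a\preceq b$, $1_aA^-1_a=\Bbbk1_a=1_aA^+1_a$, and multiplication $A^-\otimes_{\mathbb K}A^\circ\otimes_{\mathbb K}A^+\to A$ is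 bijective, where $\mathbb K=\bigoplus_a\Bbbk 1_a$. Fix bases $Y(b,a)$ of $1_bA^-1_a$, $H(a)$ of $1_aA^\circ1_a$ and $X(a,b)$ of $1_aA^+1_b$. 2. $\tau_A$ maps $X(a,b)$ into $X(a+1,b+1)$, $Y(b,a)$ into $Y(b+1,a+1)$ and $H(a)$ into $H(a+1)$. 3. For each $m$ there is $D(m+1)\subseteq H(m+1)$ with $|H(m+1)|=|D(m+1)|\,|H(m)|$ and $H(m+1)=\{d\,\tau_A(h): d\in D(m+1),\,h\in H(m)\}$. 4. For each $m$, the elements $\tau_A(y)$ with $y\in\bigcup_bY(b,m-1)$ (none if $m=0$) together with the elements $\tau_A(f)\,\tau_A(d)\,(1_m\otimes\mathrm{cup})$ with $f\in\bigcup_bY(b,m+1)$, $d\in D(m+1)$, all of them indexed by $y$ and by $(f,d)$, form a basis of $\bigoplus_{b>0}1_bA^-1_m$. 5. There is a $\Bbbk$-linear monoidal contravariant functor $\sigma:\mathcal C\to\mathcal C$ with $\sigma^2=\mathrm{Id}$ which fixes the generating object and preserves $K$. It induces anti-involutions of $A$ and of every $\bar A_m$. 6. Each $\bar A_m$ is a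 cellular algebra, with a cellular basis $\{c^\lambda_{s,t}:\lambda\in\Lambda_m,\ s,t\in T(\lambda)\}$ for the anti-involution induced by $\sigma$; let $S_m(\lambda)$, $\lambda\in\Lambda_m$, be its left cell modules. 7. For all $m$, $i\in\Bbbk$ and $\lambda\in\Lambda_m$ there are $\mathscr A_{i,\lambda}\subseteq\Lambda_{m+1}$ and (if $m\geq1$) $\mathscr R_{i,\lambda}\subseteq\Lambda_{m-1}$ such that $\bar F_iS_m(\lambda)$ has a finite filtration with sections $S_{m+1}(\mu)$, $\mu\in\mathscr A_{i,\lambda}$, each occurring once, and, if $m\geq1$, $\bar E_iS_m(\lambda)$ has a finite filtration with sections $S_{m-1}(\mu)$, $\mu\in\mathscr R_{i,\lambda}$, each occurring once. 8. $\mu\in\mathscr A_{i,\lambda}$ if and only if $\lambda\in\mathscr R_{i,\mu}$. 9. $\bar A_0=\Bbbk\bar 1_0\cong\Bbbk$. 10. For every $m$, every simple $\bar A_m$-module $L_m(\mu)$ and its projective cover $P_m(\mu)$ are isomorphic to their duals. Here the dual of $V$ is $\operatorname{Hom}_\Bbbk(V,\Bbbk)$ with $(xf)(v)=f(\sigma(x)v)$.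 Let $\mu$ run over the isomorphism classes of pairs consisting of some $m$ and a simple $\bar A_m$-module $L_m(\mu)$ with projective cover $P_m(\mu)$. Put $\Delta(\mu)=\Delta(P_m(\mu))$, let $L(\mu)$ be its unique irreducible quotient, and let $P(\mu)$ be the projective cover of $L(\mu)$ in $A$-mod. **Theorem.** Suppose that $\mathbb I_0\cap\mathbb I_0^\sharp=\emptyset$. Then 1. for all $\mu$, $\Delta(\mu)$ has a unique irreducible quotient $L(\mu)$, and $P(\mu)=\Delta(\mu)$, that is, $\Delta(\mu)\to L(\mu)$ is a projective cover in $A$-mod; 2. $\Delta:\bar A^\circ\text{-mod}\to A\text{-mod}$ is an equivalence of categories. -/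

import Mathlib

open CategoryTheory
open scoped TensorProduct ModuleCat.Algebra

universe u v

namespace WeaklyTriangular

/-! ### Locally unital algebras and their modules -/

/-- A locally unital `𝕜`-algebra `B = ⨁_{a,b} 1_a B 1_b` with distinguished orthogonal idempotents
`1_a`, `a ∈ ℕ`, given by its Peirce components `E a b = 1_a B 1_b` and their multiplication
`1_a B 1_b × 1_b B 1_c → 1_a B 1_c` (all other products of components being zero). -/
structure LUAlg (𝕜 : Type u) [Field 𝕜] where
  E : ℕ → ℕ → Type u
  [acg : ∀ a b, AddCommGroup (E a b)]
  [mod : ∀ a b, Module 𝕜 (E a b)]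
  mul : ∀ {a b c : ℕ}, E a b →ₗ[𝕜] E b c →ₗ[𝕜] E a c
  one : ∀ a : ℕ, E a a
  one_mul : ∀ {a b : ℕ} (x : E a b), mul (one a) x = x
  mul_one : ∀ {a b : ℕ} (x : E a b), mul x (one b) = x
  mul_assoc : ∀ {a b c d : ℕ} (x : E a b) (y : E b c) (z : E c d),
    mul (mul x y) z = mul x (mul y z)

attribute [instance] LUAlg.acg LUAlg.mod

namespace LUAlg

variable {𝕜 : Type u} [Field 𝕜]

/-- The centralizer algebra `B_a = 1_a B 1_a`, a unital algebra with identity `1_a`. -/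
instance ring (B : LUAlg 𝕜) (a : ℕ) : Ring (B.E a a) :=
  { B.acg a a with
    mul := fun x y => B.mul x y
    one := B.one a
    mul_assoc := fun x y z => B.mul_assoc x y z
    one_mul := fun x => B.one_mul x
    mul_one := fun x => B.mul_one x
    left_distrib := fun x y z => map_add (B.mul x) y z
    right_distrib := fun x y z => by
      change B.mul (x + y) z = _
      rw [map_add]; rfl
    zero_mul := fun x => by
      change B.mul 0 x = 0
      rw [map_zero]; rfl
    mul_zero := fun x => map_zero (B.mul x) }

instance algebra (B : LUAlg 𝕜) (a : ℕ) : Algebra 𝕜 (B.E a a) :=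
  Algebra.ofModule
    (fun c x y => by
      change B.mul (c • x) y = c • B.mul x y
      rw [map_smul]; rfl)
    (fun c x y => map_smul (B.mul x) c y)

/-- A two-sided ideal `I = ⨁_{a,b} 1_a I 1_b` of a locally unital algebra. -/
structure Ideal (B : LUAlg 𝕜) where
  carrier : ∀ a b : ℕ, Submodule 𝕜 (B.E a b)
  mul_left : ∀ {a b c : ℕ} (x : B.E a b) {y : B.E b c}, y ∈ carrier b c → B.mul x y ∈ carrier a c
  mul_right : ∀ {a b c : ℕ} {x : B.E a b} (y : B.E b c), x ∈ carrier a b → B.mul x y ∈ carrier a c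

/-- The two-sided ideal generated by the idempotents `1_c`, `c ∈ S`. -/
def idempotentIdeal (B : LUAlg 𝕜) (S : Set ℕ) : B.Ideal where
  carrier a b := Submodule.span 𝕜
    {x | ∃ c ∈ S, ∃ (f : B.E a c) (g : B.E c b), x = B.mul f g}
  mul_left {a b c} x y hy := by
    induction hy using Submodule.span_induction with
    | mem y hy =>
      obtain ⟨d, hd, f, g, rfl⟩ := hy
      exact Submodule.subset_span ⟨d, hd, B.mul x f, g, (B.mul_assoc _ _ _).symm⟩
    | zero => simp
    | add y z _ _ h₁ h₂ => rw [map_add]; exact add_mem h₁ h₂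
    | smul r y _ h => rw [map_smul]; exact Submodule.smul_mem _ _ h
  mul_right {a b c} x y hx := by
    induction hx using Submodule.span_induction with
    | mem x hx =>
      obtain ⟨d, hd, f, g, rfl⟩ := hx
      exact Submodule.subset_span ⟨d, hd, f, B.mul g y, B.mul_assoc _ _ _⟩
    | zero => simp
    | add x z _ _ h₁ h₂ => rw [map_add, LinearMap.add_apply]; exact add_mem h₁ h₂
    | smul r x _ h => rw [map_smul, LinearMap.smul_apply]; exact Submodule.smul_mem _ _ h

/-- The multiplication induced on the components of the quotient by a two-sided ideal. -/
def quotMul {B : LUAlg 𝕜} (I : B.Ideal) (a b c : ℕ) :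
    (B.E a b ⧸ I.carrier a b) →ₗ[𝕜] (B.E b c ⧸ I.carrier b c) →ₗ[𝕜] (B.E a c ⧸ I.carrier a c) :=
  Submodule.liftQ (I.carrier a b)
    { toFun := fun x => Submodule.mapQ (I.carrier b c) (I.carrier a c) (B.mul x)
        (fun _ hy => I.mul_left x hy)
      map_add' := fun x y => by
        apply Submodule.linearMap_qext
        ext z
        simp
      map_smul' := fun r x => by
        apply Submodule.linearMap_qext
        ext z
        simp }
    (fun x hx => by
      rw [LinearMap.mem_ker]
      apply Submodule.linearMap_qext
      ext z
      simpa using I.mul_right z hx)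

theorem quotMul_mk {B : LUAlg 𝕜} (I : B.Ideal) {a b c : ℕ} (x : B.E a b) (y : B.E b c) :
    quotMul I a b c (Submodule.Quotient.mk x) (Submodule.Quotient.mk y) =
      Submodule.Quotient.mk (B.mul x y) := rfl

/-- The quotient algebra `B / I`. -/
def quot (B : LUAlg 𝕜) (I : B.Ideal) : LUAlg 𝕜 where
  E a b := B.E a b ⧸ I.carrier a b
  mul {a b c} := quotMul I a b c
  one a := Submodule.Quotient.mk (B.one a)
  one_mul x := by
    obtain ⟨x, rfl⟩ := Submodule.Quotient.mk_surjective _ x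
    rw [quotMul_mk, B.one_mul]
  mul_one x := by
    obtain ⟨x, rfl⟩ := Submodule.Quotient.mk_surjective _ x
    rw [quotMul_mk, B.mul_one]
  mul_assoc x y z := by
    obtain ⟨x, rfl⟩ := Submodule.Quotient.mk_surjective _ x
    obtain ⟨y, rfl⟩ := Submodule.Quotient.mk_surjective _ y
    obtain ⟨z, rfl⟩ := Submodule.Quotient.mk_surjective _ z
    simp only [quotMul_mk, B.mul_assoc]

/-- The projection `B → B / I`, component by component. -/
def toQuot (B : LUAlg 𝕜) (I : B.Ideal) (a b : ℕ) : B.E a b →ₗ[𝕜] (B.quot I).E a b :=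
  (I.carrier a b).mkQ

/-- A left module `M = ⨁_a 1_a M` over a locally unital algebra, given by its weight spaces
`X a = 1_a M` and the action maps `1_a B 1_b × 1_b M → 1_a M`. -/
structure Mod (B : LUAlg 𝕜) where
  X : ℕ → Type u
  [acg : ∀ a, AddCommGroup (X a)]
  [mod : ∀ a, Module 𝕜 (X a)]
  act : ∀ {a b : ℕ}, B.E a b →ₗ[𝕜] X b →ₗ[𝕜] X a
  one_act : ∀ {a : ℕ} (x : X a), act (B.one a) x = x
  mul_act : ∀ {a b c : ℕ} (f : B.E a b) (g : B.E b c) (x : X c),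
    act (B.mul f g) x = act f (act g x)

attribute [instance] Mod.acg Mod.mod

/-- A homomorphism of left `B`-modules. -/
@[ext]
structure Mod.Hom {B : LUAlg 𝕜} (M N : B.Mod) where
  app : ∀ a : ℕ, M.X a →ₗ[𝕜] N.X a
  comm : ∀ {a b : ℕ} (f : B.E a b) (x : M.X b), app a (M.act f x) = N.act f (app b x)

/-- The category `B`-mod of all left `B`-modules. -/
instance (B : LUAlg 𝕜) : Category B.Mod where
  Hom M N := Mod.Hom M N
  id M := ⟨fun _ => LinearMap.id, fun _ _ => rfl⟩
  comp φ ψ := ⟨fun a => (ψ.app a).comp (φ.app a), fun f x => by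
    simp only [LinearMap.comp_apply, φ.comm, ψ.comm]⟩

instance (B : LUAlg 𝕜) : Limits.HasZeroMorphisms B.Mod where
  zero M N := ⟨⟨fun _ => 0, fun f x => by simp⟩⟩
  comp_zero φ N := by
    apply Mod.Hom.ext
    funext a
    exact LinearMap.zero_comp _
  zero_comp M _ _ ψ := by
    apply Mod.Hom.ext
    funext a
    exact LinearMap.comp_zero _

/-- The direct sum `⨁_m M_m` of a sequence of `B`-modules. -/
noncomputable def Mod.directSum {B : LUAlg 𝕜} (M : ℕ → B.Mod) : B.Mod where
  X a := DirectSum ℕ (fun m => (M m).X a)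
  act {a b} :=
    { toFun := fun f => DirectSum.lmap (fun m => (M m).act f)
      map_add' := fun f g => by
        ext m x : 2
        simp [DirectSum.lmap_lof]
      map_smul' := fun r f => by
        ext m x : 2
        simp [DirectSum.lmap_lof] }
  one_act {a} x := by
    have h : DirectSum.lmap (fun m => (M m).act (B.one a)) = LinearMap.id (R := 𝕜) := by
      ext m x : 2
      simp [DirectSum.lmap_lof, (M m).one_act]
    exact congrArg (fun φ => φ x) h
  mul_act {a b c} f g x := by
    have h : DirectSum.lmap (fun m => (M m).act (B.mul f g)) =
        (DirectSum.lmap (fun m => (M m).act f)).comp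
          (DirectSum.lmap (R := 𝕜) (fun m => (M m).act g)) := by
      ext m x : 2
      simp [DirectSum.lmap_lof, (M m).mul_act]
    exact congrArg (fun φ => φ x) h

/-- The direct sum of a sequence of homomorphisms. -/
noncomputable def Mod.directSumMap {B : LUAlg 𝕜} {M N : ℕ → B.Mod} (φ : ∀ m, M m ⟶ N m) :
    Mod.directSum M ⟶ Mod.directSum N where
  app a := DirectSum.lmap (fun m => (φ m).app a)
  comm {a b} f x := by
    have h : (DirectSum.lmap (fun m => (φ m).app a)).comp
          (DirectSum.lmap (R := 𝕜) (fun m => (M m).act f)) =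
        (DirectSum.lmap (fun m => (N m).act f)).comp
          (DirectSum.lmap (R := 𝕜) (fun m => (φ m).app b)) := by
      ext m x : 2
      simp [DirectSum.lmap_lof, (φ m).comm]
    exact congrArg (fun φ => φ x) h

theorem Mod.directSumMap_id {B : LUAlg 𝕜} (M : ℕ → B.Mod) :
    Mod.directSumMap (fun m => 𝟙 (M m)) = 𝟙 (Mod.directSum M) := by
  apply Mod.Hom.ext
  funext a
  exact DirectSum.lmap_id

theorem Mod.directSumMap_comp {B : LUAlg 𝕜} {M N L : ℕ → B.Mod} (φ : ∀ m, M m ⟶ N m)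
    (ψ : ∀ m, N m ⟶ L m) :
    Mod.directSumMap (fun m => φ m ≫ ψ m) = Mod.directSumMap φ ≫ Mod.directSumMap ψ := by
  apply Mod.Hom.ext
  funext a
  exact DirectSum.lmap_comp _ _

end LUAlg

/-! ### Tensor products over a noncommutative algebra -/

/-- Let `M` carry a right action `ρ` of the algebra `R` and a commuting left action of `S`. This is
the sub-`S`-module of `M ⊗_𝕜 V` generated by the elements `m r ⊗ v - m ⊗ r v`. -/
def balancing (𝕜 S : Type u) {M R V : Type u} [Field 𝕜] [Ring S] [Ring R] [AddCommGroup M]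
    [Module 𝕜 M] [Module S M] [SMulCommClass 𝕜 S M] [AddCommGroup V] [Module 𝕜 V] [Module R V]
    (ρ : M → R → M) : Submodule S (M ⊗[𝕜] V) :=
  Submodule.span S {t | ∃ (m : M) (r : R) (v : V), t = ρ m r ⊗ₜ[𝕜] v - m ⊗ₜ[𝕜] (r • v)}

/-- The tensor product `M ⊗_R V` of an `(S, R)`-bimodule and a left `R`-module, as a left
`S`-module. -/
abbrev BalTensor (𝕜 S : Type u) {M R : Type u} (V : Type u) [Field 𝕜] [Ring S] [Ring R]
    [AddCommGroup M] [Module 𝕜 M] [Module S M] [SMulCommClass 𝕜 S M] [AddCommGroup V] [Module 𝕜 V]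
    [Module R V] (ρ : M → R → M) : Type u :=
  (M ⊗[𝕜] V) ⧸ (balancing 𝕜 S (V := V) ρ)

namespace BalTensor

variable {𝕜 M M' R V V' : Type u} [Field 𝕜] [Ring R] [AddCommGroup M] [Module 𝕜 M]
  [AddCommGroup M'] [Module 𝕜 M'] [AddCommGroup V] [Module 𝕜 V] [Module R V]
  [AddCommGroup V'] [Module 𝕜 V'] [Module R V'] {ρ : M → R → M} {ρ' : M' → R → M'}

/-- The map `φ ⊗ g` on `M ⊗_R V`. -/
noncomputable def map (φ : M →ₗ[𝕜] M') (g : V →ₗ[𝕜] V') (hφ : ∀ m r, φ (ρ m r) = ρ' (φ m) r)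
    (hg : ∀ (r : R) (v : V), g (r • v) = r • g v) :
    BalTensor 𝕜 𝕜 V ρ →ₗ[𝕜] BalTensor 𝕜 𝕜 V' ρ' :=
  Submodule.mapQ _ _ (TensorProduct.map φ g) (by
    unfold balancing
    rw [Submodule.span_le]
    rintro _ ⟨x, r, v, rfl⟩
    refine Submodule.subset_span ⟨φ x, r, g v, ?_⟩
    rw [map_sub, TensorProduct.map_tmul, TensorProduct.map_tmul, hφ, hg])

theorem map_tmul (φ : M →ₗ[𝕜] M') (g : V →ₗ[𝕜] V') (hφ : ∀ m r, φ (ρ m r) = ρ' (φ m) r)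
    (hg : ∀ (r : R) (v : V), g (r • v) = r • g v) (x : M) (v : V) :
    map (ρ := ρ) (ρ' := ρ') φ g hφ hg (Submodule.Quotient.mk (x ⊗ₜ[𝕜] v)) =
      Submodule.Quotient.mk (φ x ⊗ₜ[𝕜] g v) := rfl

theorem hom_ext {N : Type u} [AddCommGroup N] [Module 𝕜 N] {f g : BalTensor 𝕜 𝕜 V ρ →ₗ[𝕜] N}
    (h : ∀ (x : M) (v : V), f (Submodule.Quotient.mk (x ⊗ₜ[𝕜] v)) =
      g (Submodule.Quotient.mk (x ⊗ₜ[𝕜] v))) : f = g := by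
  apply Submodule.linearMap_qext
  exact TensorProduct.ext' h

end BalTensor

/-! ### Truncations and the standardization functor -/

/-- The partial order on `ℕ`: `i ⪯ j` iff `i = j + 2 s` for some `s ∈ ℕ`. -/
def Prec (i j : ℕ) : Prop := ∃ s : ℕ, i = j + 2 * s

namespace LUAlg

variable {𝕜 : Type u} [Field 𝕜]

/-- The ideal `B^{⋠ m}` generated by all `1_c` with `c ⋠ m`. -/
def notPrecIdeal (B : LUAlg 𝕜) (m : ℕ) : B.Ideal := B.idempotentIdeal {c | ¬ Prec c m}

/-- The quotient algebra `B_{⪯ m} = B / B^{⋠ m}`. -/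
def trunc (B : LUAlg 𝕜) (m : ℕ) : LUAlg 𝕜 := B.quot (B.notPrecIdeal m)

/-- The projection `B → B_{⪯ m}`, component by component. -/
def toTrunc (B : LUAlg 𝕜) (m a b : ℕ) : B.E a b →ₗ[𝕜] (B.trunc m).E a b :=
  B.toQuot (B.notPrecIdeal m) a b

theorem toTrunc_one (B : LUAlg 𝕜) (m a : ℕ) :
    B.toTrunc m a a (B.one a) = (B.trunc m).one a := rfl

theorem toTrunc_mul (B : LUAlg 𝕜) (m : ℕ) {a b c : ℕ} (f : B.E a b) (g : B.E b c) :
    B.toTrunc m a c (B.mul f g) =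
      (B.trunc m).mul (B.toTrunc m a b f) (B.toTrunc m b c g) := rfl

/-- The unital algebra `B̄_m = 1̄_m B_{⪯ m} 1̄_m`. -/
abbrev Bar (B : LUAlg 𝕜) (m : ℕ) : Type u := (B.trunc m).E m m

/-- The right action of `B̄_m` on `1_b B_{⪯ m} 1̄_m`. -/
def stdRight (B : LUAlg 𝕜) (m b : ℕ) (x : (B.trunc m).E b m) (r : B.Bar m) :
    (B.trunc m).E b m := (B.trunc m).mul x r

theorem mul_stdRight (B : LUAlg 𝕜) (m : ℕ) {a b : ℕ} (f : (B.trunc m).E a b)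
    (x : (B.trunc m).E b m) (r : B.Bar m) :
    (B.trunc m).mul f (B.stdRight m b x r) = B.stdRight m a ((B.trunc m).mul f x) r :=
  ((B.trunc m).mul_assoc f x r).symm

/-- The action of `f ∈ 1_a B 1_b` on `B_{⪯ m} 1̄_m ⊗_{B̄_m} V`: `f (x ⊗ v) = f̄ x ⊗ v`. -/
noncomputable def stdAct (B : LUAlg 𝕜) (m : ℕ) (V : ModuleCat.{u} (B.Bar m)) {a b : ℕ}
    (f : B.E a b) :
    BalTensor 𝕜 𝕜 V (B.stdRight m b) →ₗ[𝕜] BalTensor 𝕜 𝕜 V (B.stdRight m a) :=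
  BalTensor.map ((B.trunc m).mul (B.toTrunc m a b f)) LinearMap.id
    (fun x r => B.mul_stdRight m _ x r) (fun _ _ => rfl)

theorem stdAct_tmul (B : LUAlg 𝕜) (m : ℕ) (V : ModuleCat.{u} (B.Bar m)) {a b : ℕ}
    (f : B.E a b) (x : (B.trunc m).E b m) (v : V) :
    B.stdAct m V f (Submodule.Quotient.mk (x ⊗ₜ[𝕜] v)) =
      Submodule.Quotient.mk ((B.trunc m).mul (B.toTrunc m a b f) x ⊗ₜ[𝕜] v) := rfl

/-- The functor `j^m_! = B_{⪯ m} 1̄_m ⊗_{B̄_m} ?` on objects. -/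
noncomputable def stdObj (B : LUAlg 𝕜) (m : ℕ) (V : ModuleCat.{u} (B.Bar m)) : B.Mod where
  X b := BalTensor 𝕜 𝕜 V (B.stdRight m b)
  act {a b} :=
    { toFun := fun f => B.stdAct m V f
      map_add' := fun f g => by
        apply BalTensor.hom_ext
        intro x v
        rw [LinearMap.add_apply, stdAct_tmul, stdAct_tmul, stdAct_tmul, map_add, map_add,
          LinearMap.add_apply, TensorProduct.add_tmul, Submodule.Quotient.mk_add]
      map_smul' := fun c f => by
        apply BalTensor.hom_ext
        intro x v
        rw [RingHom.id_apply, LinearMap.smul_apply, stdAct_tmul, stdAct_tmul,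
          map_smul, map_smul, LinearMap.smul_apply, ← TensorProduct.smul_tmul',
          Submodule.Quotient.mk_smul] }
  one_act {a} x := by
    have h : B.stdAct m V (B.one a) = LinearMap.id := by
      apply BalTensor.hom_ext
      intro x v
      rw [stdAct_tmul, toTrunc_one, LUAlg.one_mul, LinearMap.id_apply]
    exact congrArg (fun φ => φ x) h
  mul_act {a b c} f g x := by
    have h : B.stdAct m V (B.mul f g) = (B.stdAct m V f).comp (B.stdAct m V g) := by
      apply BalTensor.hom_ext
      intro x v
      rw [LinearMap.comp_apply, stdAct_tmul, stdAct_tmul, stdAct_tmul, toTrunc_mul,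
        LUAlg.mul_assoc]
    exact congrArg (fun φ => φ x) h

/-- The functor `j^m_!` on morphisms: `x ⊗ v ↦ x ⊗ g v`. -/
noncomputable def stdMap (B : LUAlg 𝕜) (m : ℕ) {V W : ModuleCat.{u} (B.Bar m)} (g : V ⟶ W)
    (b : ℕ) : BalTensor 𝕜 𝕜 V (B.stdRight m b) →ₗ[𝕜] BalTensor 𝕜 𝕜 W (B.stdRight m b) :=
  BalTensor.map LinearMap.id (g.hom.restrictScalars 𝕜) (fun _ _ => rfl)
    (fun r v => map_smul g.hom r v)

/-- The functor `j^m_! : B̄_m`-mod `→ B`-mod. -/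
noncomputable def std (B : LUAlg 𝕜) (m : ℕ) : ModuleCat.{u} (B.Bar m) ⥤ B.Mod where
  obj V := B.stdObj m V
  map {V W} g :=
    { app := fun b => B.stdMap m g b
      comm := fun {a b} f x => by
        have h : (B.stdMap m g a).comp (B.stdAct m V f) =
            (B.stdAct m W f).comp (B.stdMap m g b) := by
          apply BalTensor.hom_ext
          intro x v
          rfl
        exact congrArg (fun φ => φ x) h }
  map_id V := by
    apply Mod.Hom.ext
    funext b
    apply BalTensor.hom_ext
    intro x v
    rfl
  map_comp g h := by
    apply Mod.Hom.ext
    funext b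
    apply BalTensor.hom_ext
    intro x v
    rfl

/-- The category `B̄°`-mod of left modules over `B̄° = ⨁_m B̄_m`: such a module is a sequence of
modules over the algebras `B̄_m`. -/
abbrev BarMod (B : LUAlg 𝕜) : Type (u + 1) := ∀ m : ℕ, ModuleCat.{u} (B.Bar m)

/-- The standardization functor `Δ = ⨁_m j^m_! : B̄°`-mod `→ B`-mod. -/
noncomputable def Delta (B : LUAlg 𝕜) : B.BarMod ⥤ B.Mod where
  obj V := Mod.directSum fun m => (B.std m).obj (V m)
  map φ := Mod.directSumMap fun m => (B.std m).map (φ m)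
  map_id V := by
    have h : (fun m => (B.std m).map ((𝟙 V : V ⟶ V) m)) = fun m => 𝟙 ((B.std m).obj (V m)) :=
      funext fun m => (B.std m).map_id (V m)
    rw [h]
    exact Mod.directSumMap_id _
  map_comp {U V W} φ ψ := by
    have h : (fun m => (B.std m).map ((φ ≫ ψ) m)) =
        fun m => (B.std m).map (φ m) ≫ (B.std m).map (ψ m) :=
      funext fun m => (B.std m).map_comp (φ m) (ψ m)
    rw [h]
    exact Mod.directSumMap_comp _ _

end LUAlg

/-! ### Projective covers and heads -/

/-- `p : P ⟶ L` is a projective cover: `P` is projective and `p` is an essential epimorphism. -/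
def IsProjectiveCover {C : Type*} [Category C] {P L : C} (p : P ⟶ L) : Prop :=
  Projective P ∧ Epi p ∧ ∀ ⦃Q : C⦄ (g : Q ⟶ P), Epi (g ≫ p) → Epi g

/-- `q : M ⟶ L` is the unique irreducible quotient of `M`. -/
def IsUniqueIrreducibleQuotient {C : Type*} [Category C] [Limits.HasZeroMorphisms C] {M L : C}
    (q : M ⟶ L) : Prop :=
  Simple L ∧ Epi q ∧ ∀ ⦃L' : C⦄ (q' : M ⟶ L'), Simple L' → Epi q' → ∃ e : L ≅ L', q ≫ e.hom = q'


/-! ### Weakly triangular decompositions -/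

/-- A weakly triangular decomposition `(ℕ, B⁻, B°, B⁺)` of a locally unital algebra with respect to
the order `⪯` on `ℕ` (every equivalence class of objects being a singleton). Here
`B^± = ⨁_{a,b} 1_a B^± 1_b` and `B° = ⨁_a 1_a B° 1_a`; the order is upper finite. -/
structure WeaklyTriangularDecomposition {𝕜 : Type u} [Field 𝕜] (B : LUAlg 𝕜) where
  neg : ∀ a b : ℕ, Submodule 𝕜 (B.E a b)
  circ : ∀ a : ℕ, Submodule 𝕜 (B.E a a)
  pos : ∀ a b : ℕ, Submodule 𝕜 (B.E a b)
  neg_eq_bot : ∀ a b : ℕ, ¬ Prec a b → neg a b = ⊥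
  pos_eq_bot : ∀ a b : ℕ, ¬ Prec a b → pos b a = ⊥
  neg_self : ∀ a : ℕ, neg a a = Submodule.span 𝕜 {B.one a}
  pos_self : ∀ a : ℕ, pos a a = Submodule.span 𝕜 {B.one a}
  /-- Multiplication `B⁻ ⊗ B° ⊗ B⁺ → B` is bijective, the tensor products being taken over
  `⨁_b 𝕜 1_b`; in other words the following map is bijective for all `a, c`. -/
  bijective : ∀ a c : ℕ, Function.Bijective
    (DirectSum.toModule 𝕜 ℕ (B.E a c) fun b =>
      TensorProduct.lift
        ((B.mul.comp (TensorProduct.lift (B.mul.domRestrict₁₂ (neg a b) (circ b)))).compl₂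
          (pos b c).subtype) :
      DirectSum ℕ (fun b => ((neg a b) ⊗[𝕜] (circ b)) ⊗[𝕜] (pos b c)) →ₗ[𝕜] B.E a c)

/-- `S` is a basis of the subspace `U`. -/
def IsBasisOf {𝕜 V : Type u} [Field 𝕜] [AddCommGroup V] [Module 𝕜 V] (S : Set V)
    (U : Submodule 𝕜 V) : Prop :=
  LinearIndepOn 𝕜 id S ∧ Submodule.span 𝕜 S = U

/-- Bases `Y(b, a)` of `1_b B⁻ 1_a`, `H(a)` of `1_a B° 1_a` and `X(a, b)` of `1_a B⁺ 1_b`. -/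
structure WeaklyTriangularDecomposition.Bases {𝕜 : Type u} [Field 𝕜] {B : LUAlg 𝕜}
    (W : WeaklyTriangularDecomposition B) where
  Y : ∀ b a : ℕ, Set (B.E b a)
  H : ∀ a : ℕ, Set (B.E a a)
  X : ∀ a b : ℕ, Set (B.E a b)
  Y_basis : ∀ b a, IsBasisOf (Y b a) (W.neg b a)
  H_basis : ∀ a, IsBasisOf (H a) (W.circ a)
  X_basis : ∀ a b, IsBasisOf (X a b) (W.pos a b)

/-! ### Strict monoidal categories generated by one object -/

/-- A `𝕜`-linear strict monoidal category with a single generating object: the objects are the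
natural numbers (`m` is the `m`-th tensor power of the generating object `1`, and `0` is the unit
object), and the tensor product of objects is addition. -/
structure StrandCategory (𝕜 : Type u) [Field 𝕜] where
  /-- `Hom a b` is the space of morphisms from `a` to `b`. -/
  Hom : ℕ → ℕ → Type u
  [acg : ∀ a b, AddCommGroup (Hom a b)]
  [mod : ∀ a b, Module 𝕜 (Hom a b)]
  id : ∀ a : ℕ, Hom a a
  /-- `comp g f = g ∘ f`. -/
  comp : ∀ {a b c : ℕ}, Hom b c →ₗ[𝕜] Hom a b →ₗ[𝕜] Hom a c
  /-- `tensor f g = f ⊗ g`: the diagram `f` to the left of the diagram `g`. -/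
  tensor : ∀ {a b c d : ℕ}, Hom a b →ₗ[𝕜] Hom c d →ₗ[𝕜] Hom (a + c) (b + d)
  id_comp : ∀ {a b : ℕ} (f : Hom a b), comp (id b) f = f
  comp_id : ∀ {a b : ℕ} (f : Hom a b), comp f (id a) = f
  comp_assoc : ∀ {a b c d : ℕ} (h : Hom c d) (g : Hom b c) (f : Hom a b),
    comp (comp h g) f = comp h (comp g f)
  tensor_id : ∀ a b : ℕ, tensor (id a) (id b) = id (a + b)
  tensor_comp : ∀ {a b c a' b' c' : ℕ} (g : Hom b c) (f : Hom a b) (g' : Hom b' c')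
    (f' : Hom a' b'), tensor (comp g f) (comp g' f') = comp (tensor g g') (tensor f f')
  tensor_assoc : ∀ {a b c d e f : ℕ} (x : Hom a b) (y : Hom c d) (z : Hom e f),
    HEq (tensor (tensor x y) z) (tensor x (tensor y z))
  tensor_unit : ∀ {a b : ℕ} (f : Hom a b), tensor f (id 0) = f
  unit_tensor : ∀ {a b : ℕ} (f : Hom a b), HEq (tensor (id 0) f) f

attribute [instance] StrandCategory.acg StrandCategory.mod

/-- The two kinds of strict monoidal categories. -/
inductive Kind
  | first
  | second

/-- The map `♯`: `i ↦ -i` for the first kind, `i ↦ i⁻¹` for the second kind. In the second kind only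
non-zero `i` are relevant. -/
def sharp {𝕜 : Type u} [Field 𝕜] : Kind → 𝕜 → 𝕜
  | Kind.first, i => -i
  | Kind.second, i => i⁻¹

namespace StrandCategory

variable {𝕜 : Type u} [Field 𝕜]

/-- The locally unital algebra `⨁_{a,b} Hom(b, a)` of a category with object set `ℕ`. -/
def alg (P : StrandCategory 𝕜) : LUAlg 𝕜 where
  E a b := P.Hom b a
  mul {_ _ _} := P.comp
  one := P.id
  one_mul := P.id_comp
  mul_one := P.comp_id
  mul_assoc := P.comp_assoc

/-- A cap, a cup and a dot satisfying the zig-zag relations. -/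
structure Generators (P : StrandCategory 𝕜) where
  cap : P.Hom 2 0
  cup : P.Hom 0 2
  dot : P.Hom 1 1
  zigzag_left : P.comp (P.tensor (P.id 1) cap : P.Hom 3 1) (P.tensor cup (P.id 1) : P.Hom 1 3) =
    P.id 1
  zigzag_right : P.comp (P.tensor cap (P.id 1) : P.Hom 3 1) (P.tensor (P.id 1) cup : P.Hom 1 3) =
    P.id 1

/-- The further relations. First kind: a dot changes its sign when it slides over the cap. Second
kind: the dot `•` has a two-sided inverse `∘`, and turns into `∘` when it slides over the cap. -/
def Generators.Relations {P : StrandCategory 𝕜} (G : P.Generators) : Kind → Prop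
  | Kind.first =>
      P.comp G.cap (P.tensor G.dot (P.id 1) : P.Hom 2 2) =
        - P.comp G.cap (P.tensor (P.id 1) G.dot : P.Hom 2 2)
  | Kind.second => ∃ odot : P.Hom 1 1,
      P.comp G.dot odot = P.id 1 ∧ P.comp odot G.dot = P.id 1 ∧
      P.comp G.cap (P.tensor G.dot (P.id 1) : P.Hom 2 2) =
        P.comp G.cap (P.tensor (P.id 1) odot : P.Hom 2 2)

/-- A right tensor ideal of a strict monoidal category. -/
structure RightTensorIdeal (P : StrandCategory 𝕜) where
  carrier : ∀ a b : ℕ, Submodule 𝕜 (P.Hom a b)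
  comp_left : ∀ {a b c : ℕ} (g : P.Hom b c) {f : P.Hom a b}, f ∈ carrier a b →
    P.comp g f ∈ carrier a c
  comp_right : ∀ {a b c : ℕ} {g : P.Hom b c} (f : P.Hom a b), g ∈ carrier b c →
    P.comp g f ∈ carrier a c
  tensor_right : ∀ {a b c d : ℕ} {f : P.Hom a b} (g : P.Hom c d), f ∈ carrier a b →
    P.tensor f g ∈ carrier (a + c) (b + d)

namespace RightTensorIdeal

variable {P : StrandCategory 𝕜} (K : P.RightTensorIdeal)

/-- The two-sided ideal of the algebra of `P` corresponding to `K`. -/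
def toIdeal : P.alg.Ideal where
  carrier a b := K.carrier b a
  mul_left x _ hy := K.comp_left x hy
  mul_right y hx := K.comp_right y hx

/-- The algebra `A = ⨁_{a,b} Hom_{P/K}(b, a)` of the quotient category `P / K`; thus
`1_a A 1_b = Hom_{P/K}(b, a)`. -/
def alg : LUAlg 𝕜 := P.alg.quot K.toIdeal

/-- The image in `A` of a morphism `f : b → a` of `P`. -/
def proj {a b : ℕ} : P.Hom b a →ₗ[𝕜] K.alg.E a b := (K.carrier b a).mkQ

theorem proj_surjective {a b : ℕ} : Function.Surjective (K.proj (a := a) (b := b)) :=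
  Submodule.mkQ_surjective _

theorem proj_mul {a b c : ℕ} (x : P.Hom b a) (y : P.Hom c b) :
    K.alg.mul (K.proj x) (K.proj y) = K.proj (P.comp x y) := rfl

/-- The map `τ_A : A → A`, `f ↦ f ⊗ 1`, adding a vertical strand on the right. -/
def tau {a b : ℕ} : K.alg.E a b →ₗ[𝕜] K.alg.E (a + 1) (b + 1) :=
  Submodule.mapQ (K.carrier b a) (K.carrier (b + 1) (a + 1)) (P.tensor.flip (P.id 1))
    (fun _ hf => K.tensor_right (P.id 1) hf)

theorem tau_proj {a b : ℕ} (f : P.Hom b a) :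
    K.tau (K.proj f) = K.proj (P.tensor f (P.id 1)) := rfl

theorem tau_mul {a b c : ℕ} (x : K.alg.E a b) (y : K.alg.E b c) :
    K.tau (K.alg.mul x y) = K.alg.mul (K.tau x) (K.tau y) := by
  obtain ⟨x, rfl⟩ := K.proj_surjective x
  obtain ⟨y, rfl⟩ := K.proj_surjective y
  rw [proj_mul, tau_proj, tau_proj, tau_proj, proj_mul]
  congr 1
  conv_lhs => rw [← P.id_comp (P.id 1)]
  exact P.tensor_comp _ _ _ _

theorem tau_one (a : ℕ) : K.tau (K.alg.one a) = K.alg.one (a + 1) :=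
  congrArg K.proj (P.tensor_id a 1)

/-- The unital algebra `Ā_m = 1̄_m A_{⪯ m} 1̄_m`. -/
abbrev Abar (m : ℕ) : Type u := K.alg.Bar m

/-- The projection `A_m → Ā_m`. -/
def toBar (m : ℕ) : K.alg.E m m →ₗ[𝕜] K.Abar m := K.alg.toTrunc m m m

theorem toBar_surjective (m : ℕ) : Function.Surjective (K.toBar m) :=
  Submodule.mkQ_surjective _

theorem toBar_mul (m : ℕ) (x y : K.alg.E m m) :
    K.toBar m (K.alg.mul x y) = K.toBar m x * K.toBar m y := rfl

theorem tau_mem {m a b : ℕ} {x : K.alg.E a b} (hx : x ∈ (K.alg.notPrecIdeal m).carrier a b) :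
    K.tau x ∈ (K.alg.notPrecIdeal (m + 1)).carrier (a + 1) (b + 1) := by
  change x ∈ Submodule.span 𝕜 _ at hx
  induction hx using Submodule.span_induction with
  | mem x hx =>
    obtain ⟨c, hc, f, g, rfl⟩ := hx
    refine Submodule.subset_span ⟨c + 1, ?_, K.tau f, K.tau g, K.tau_mul f g⟩
    rintro ⟨s, hs⟩
    exact hc ⟨s, by omega⟩
  | zero => rw [map_zero]; exact zero_mem _
  | add x y _ _ h₁ h₂ => rw [map_add]; exact add_mem h₁ h₂
  | smul r x _ h => rw [map_smul]; exact Submodule.smul_mem _ _ h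

/-- The algebra homomorphism `τ̄_m : Ā_m → Ā_{m+1}` induced by `τ_A`. -/
def tauBar (m : ℕ) : K.Abar m →ₐ[𝕜] K.Abar (m + 1) :=
  AlgHom.ofLinearMap
    (Submodule.mapQ _ ((K.alg.notPrecIdeal (m + 1)).carrier (m + 1) (m + 1)) K.tau
      (fun _ hx => K.tau_mem hx))
    (congrArg (K.toBar (m + 1)) (K.tau_one m))
    (fun x y => by
      obtain ⟨x, rfl⟩ := K.toBar_surjective m x
      obtain ⟨y, rfl⟩ := K.toBar_surjective m y
      exact congrArg (K.toBar (m + 1)) (K.tau_mul x y))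

theorem tauBar_toBar (m : ℕ) (x : K.alg.E m m) :
    K.tauBar m (K.toBar m x) = K.toBar (m + 1) (K.tau x) := rfl

/-- `Ā_{m+1}` as a left `Ā_m`-module through `τ̄_m`. -/
instance barModule (m : ℕ) : Module (K.Abar m) (K.Abar (m + 1)) :=
  Module.compHom _ (K.tauBar m).toRingHom

theorem bar_smul_def (m : ℕ) (r : K.Abar m) (x : K.Abar (m + 1)) : r • x = K.tauBar m r * x := rfl

instance barTower (m : ℕ) : IsScalarTower 𝕜 (K.Abar m) (K.Abar (m + 1)) where
  smul_assoc c r x := by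
    rw [bar_smul_def, bar_smul_def, map_smul, smul_mul_assoc]

variable (G : P.Generators)

/-- `X̄_{m+1} ∈ Ā_{m+1}`: the image of the diagram with a dot on the last of `m + 1` strands. -/
def dotBar (m : ℕ) : K.Abar (m + 1) :=
  K.toBar (m + 1) (K.proj (P.tensor (P.id m) G.dot : P.Hom (m + 1) (m + 1)))

/-- `X̄_{m+1}` centralizes `τ̄_m(Ā_m)`. -/
theorem dotBar_mul (m : ℕ) (r : K.Abar m) :
    K.dotBar G m * K.tauBar m r = K.tauBar m r * K.dotBar G m := by
  obtain ⟨r, rfl⟩ := K.toBar_surjective m r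
  obtain ⟨r, rfl⟩ := K.proj_surjective r
  rw [tauBar_toBar, tau_proj, dotBar, ← toBar_mul, ← toBar_mul, proj_mul, proj_mul]
  congr 2
  have h₁ : P.comp (P.tensor (P.id m) G.dot) (P.tensor r (P.id 1)) = P.tensor r G.dot := by
    rw [← P.tensor_comp, P.id_comp, P.comp_id]
  have h₂ : P.comp (P.tensor r (P.id 1)) (P.tensor (P.id m) G.dot) = P.tensor r G.dot := by
    rw [← P.tensor_comp, P.id_comp, P.comp_id]
  exact h₁.trans h₂.symm

/-- `(Ā_{m+1})_{L,i}`: the generalized `i`-eigenspace of left multiplication by `X̄_{m+1}` on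
`Ā_{m+1}`, a left `Ā_m`-submodule. -/
noncomputable def resBimodule (m : ℕ) (i : 𝕜) : Submodule (K.Abar m) (K.Abar (m + 1)) where
  carrier := Module.End.maxGenEigenspace (LinearMap.mulLeft 𝕜 (K.dotBar G m)) i
  add_mem' := add_mem
  zero_mem' := zero_mem _
  smul_mem' r x hx := Module.End.mapsTo_maxGenEigenspace_of_comm
    (f := LinearMap.mulLeft 𝕜 (K.dotBar G m)) (g := LinearMap.mulLeft 𝕜 (K.tauBar m r))
    (LinearMap.ext fun y => by
      simp only [Module.End.mul_apply, LinearMap.mulLeft_apply, ← mul_assoc, dotBar_mul]) i hx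

/-- The right action of `Ā_{m+1}` on `(Ā_{m+1})_{L,i}`. -/
noncomputable def resRight (m : ℕ) (i : 𝕜) (x : K.resBimodule G m i) (r : K.Abar (m + 1)) :
    K.resBimodule G m i :=
  ⟨x.1 * r, Module.End.mapsTo_maxGenEigenspace_of_comm
    (f := LinearMap.mulLeft 𝕜 (K.dotBar G m)) (g := LinearMap.mulRight 𝕜 r)
    (LinearMap.ext fun y => by
      simp only [Module.End.mul_apply, LinearMap.mulLeft_apply, LinearMap.mulRight_apply,
        mul_assoc]) i x.2⟩

/-- `(Ā_{m+1})_{R,i}`: the generalized `i`-eigenspace of right multiplication by `X̄_{m+1}` on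
`Ā_{m+1}`, a left `Ā_{m+1}`-submodule. -/
noncomputable def indBimodule (m : ℕ) (i : 𝕜) : Submodule (K.Abar (m + 1)) (K.Abar (m + 1)) where
  carrier := Module.End.maxGenEigenspace (LinearMap.mulRight 𝕜 (K.dotBar G m)) i
  add_mem' := add_mem
  zero_mem' := zero_mem _
  smul_mem' r x hx := Module.End.mapsTo_maxGenEigenspace_of_comm
    (f := LinearMap.mulRight 𝕜 (K.dotBar G m)) (g := LinearMap.mulLeft 𝕜 r)
    (LinearMap.ext fun y => by
      simp only [Module.End.mul_apply, LinearMap.mulLeft_apply, LinearMap.mulRight_apply,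
        mul_assoc]) i hx

/-- The right action of `Ā_m` on `(Ā_{m+1})_{R,i}` through `τ̄_m`. -/
noncomputable def indRight (m : ℕ) (i : 𝕜) (x : K.indBimodule G m i) (r : K.Abar m) :
    K.indBimodule G m i :=
  ⟨x.1 * K.tauBar m r, Module.End.mapsTo_maxGenEigenspace_of_comm
    (f := LinearMap.mulRight 𝕜 (K.dotBar G m)) (g := LinearMap.mulRight 𝕜 (K.tauBar m r))
    (LinearMap.ext fun y => by
      simp only [Module.End.mul_apply, LinearMap.mulRight_apply, mul_assoc, dotBar_mul]) i x.2⟩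

/-- The functor `i-res^{m+1}_m = (Ā_{m+1})_{L,i} ⊗_{Ā_{m+1}} ?` on objects. The functor `Ē_i` is the
direct sum of these functors over all `m`. -/
noncomputable def iRes (m : ℕ) (i : 𝕜) (V : ModuleCat.{u} (K.Abar (m + 1))) :
    ModuleCat.{u} (K.Abar m) :=
  ModuleCat.of (K.Abar m) (BalTensor 𝕜 (K.Abar m) V (K.resRight G m i))

/-- The functor `i-ind^{m+1}_m = (Ā_{m+1})_{R,i} ⊗_{Ā_m} ?` on objects. The functor `F̄_i` is the
direct sum of these functors over all `m`. -/
noncomputable def iInd (m : ℕ) (i : 𝕜) (V : ModuleCat.{u} (K.Abar m)) :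
    ModuleCat.{u} (K.Abar (m + 1)) :=
  ModuleCat.of (K.Abar (m + 1)) (BalTensor 𝕜 (K.Abar (m + 1)) V (K.indRight G m i))

/-- `𝕀₀ = {i ∈ 𝕜 | Ē_i ≠ 0}`. -/
def I₀ : Set 𝕜 :=
  {i | ∃ (m : ℕ) (V : ModuleCat.{u} (K.Abar (m + 1))), Nontrivial (K.iRes G m i V)}

/-- The diagram `(f ⊗ 1) ∘ (d ⊗ 1) ∘ (1_m ⊗ cup)`, for `f ∈ 1_b A 1_{m+1}` and `d ∈ A_{m+1}`. -/
def bend {b m : ℕ} (f : K.alg.E b (m + 1)) (d : K.alg.E (m + 1) (m + 1)) : K.alg.E (b + 1) m :=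
  K.alg.mul (K.tau f)
    (K.alg.mul (K.tau d) (K.proj (P.tensor (P.id m) G.cup : P.Hom m (m + 2))))

/-- Compatibility of the bases of a weakly triangular decomposition of `A` with adding a strand.
`D m` stands for the set `D(m+1) ⊆ H(m+1)`. -/
structure CompatibleBases {W : WeaklyTriangularDecomposition K.alg} (S : W.Bases)
    (D : ∀ m : ℕ, Set (K.alg.E (m + 1) (m + 1))) : Prop where
  tau_X : ∀ (a b : ℕ) (f : K.alg.E a b), f ∈ S.X a b → K.tau f ∈ S.X (a + 1) (b + 1)
  tau_Y : ∀ (b a : ℕ) (f : K.alg.E b a), f ∈ S.Y b a → K.tau f ∈ S.Y (b + 1) (a + 1)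
  tau_H : ∀ (a : ℕ) (f : K.alg.E a a), f ∈ S.H a → K.tau f ∈ S.H (a + 1)
  D_subset : ∀ m : ℕ, D m ⊆ S.H (m + 1)
  ncard_H : ∀ m : ℕ, (S.H (m + 1)).ncard = (D m).ncard * (S.H m).ncard
  H_eq : ∀ m : ℕ, S.H (m + 1) = Set.image2 (fun d h => K.alg.mul d (K.tau h)) (D m) (S.H m)
  /-- The diagrams `(f ⊗ 1)(d ⊗ 1) cup` form a basis of `⨁_{b > 0} 1_b A⁻ 1_0`. -/
  Y_zero : ∀ b : ℕ,
    LinearIndependent 𝕜 (fun p : (S.Y b 1) × (D 0) => K.bend G p.1.1 p.2.1) ∧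
    Submodule.span 𝕜 (Set.range fun p : (S.Y b 1) × (D 0) => K.bend G p.1.1 p.2.1) =
      W.neg (b + 1) 0
  /-- The diagrams `y ⊗ 1` together with the diagrams `(f ⊗ 1)(d ⊗ 1)(1_{m+1} ⊗ cup)` form a basis
  of `⨁_{b > 0} 1_b A⁻ 1_{m+1}`. -/
  Y_succ : ∀ m b : ℕ,
    LinearIndependent 𝕜 (Sum.elim (fun y : S.Y b m => K.tau y.1)
      (fun p : (S.Y b (m + 2)) × (D (m + 1)) => K.bend G p.1.1 p.2.1)) ∧
    Submodule.span 𝕜 (Set.range (Sum.elim (fun y : S.Y b m => K.tau y.1)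
      (fun p : (S.Y b (m + 2)) × (D (m + 1)) => K.bend G p.1.1 p.2.1))) = W.neg (b + 1) (m + 1)

/-- A `𝕜`-linear monoidal contravariant functor `σ : P → P` with `σ² = Id` which preserves the
generating object (hence is the identity on objects) and the ideal `K`. -/
structure Involution where
  map : ∀ {a b : ℕ}, P.Hom a b →ₗ[𝕜] P.Hom b a
  map_id : ∀ a : ℕ, map (P.id a) = P.id a
  map_comp : ∀ {a b c : ℕ} (g : P.Hom b c) (f : P.Hom a b),
    map (P.comp g f) = P.comp (map f) (map g)
  map_tensor : ∀ {a b c d : ℕ} (f : P.Hom a b) (g : P.Hom c d),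
    map (P.tensor f g) = P.tensor (map f) (map g)
  map_map : ∀ {a b : ℕ} (f : P.Hom a b), map (map f) = f
  map_mem : ∀ {a b : ℕ} {f : P.Hom a b}, f ∈ K.carrier a b → map f ∈ K.carrier b a

namespace Involution

variable {K} (σ : K.Involution)

/-- The anti-involution `σ_A` of `A`. -/
def onAlg {a b : ℕ} : K.alg.E a b →ₗ[𝕜] K.alg.E b a :=
  Submodule.mapQ (K.carrier b a) (K.carrier a b) σ.map (fun _ hf => σ.map_mem hf)

theorem onAlg_mul {a b c : ℕ} (x : K.alg.E a b) (y : K.alg.E b c) :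
    σ.onAlg (K.alg.mul x y) = K.alg.mul (σ.onAlg y) (σ.onAlg x) := by
  obtain ⟨x, rfl⟩ := K.proj_surjective x
  obtain ⟨y, rfl⟩ := K.proj_surjective y
  exact congrArg K.proj (σ.map_comp x y)

theorem onAlg_mem {m a b : ℕ} {x : K.alg.E a b} (hx : x ∈ (K.alg.notPrecIdeal m).carrier a b) :
    σ.onAlg x ∈ (K.alg.notPrecIdeal m).carrier b a := by
  change x ∈ Submodule.span 𝕜 _ at hx
  induction hx using Submodule.span_induction with
  | mem x hx =>
    obtain ⟨c, hc, f, g, rfl⟩ := hx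
    exact Submodule.subset_span ⟨c, hc, σ.onAlg g, σ.onAlg f, σ.onAlg_mul f g⟩
  | zero => rw [_root_.map_zero]; exact zero_mem _
  | add x y _ _ h₁ h₂ => rw [_root_.map_add]; exact add_mem h₁ h₂
  | smul r x _ h => rw [_root_.map_smul]; exact Submodule.smul_mem _ _ h

/-- The anti-involution `σ_{Ā_m}` of `Ā_m` induced by `σ_A`. -/
def onBar (m : ℕ) : K.Abar m →ₗ[𝕜] K.Abar m :=
  Submodule.mapQ _ ((K.alg.notPrecIdeal m).carrier m m) σ.onAlg (fun _ hx => σ.onAlg_mem hx)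

end Involution

end RightTensorIdeal

end StrandCategory

/-! ### Cellular algebras -/

/-- A cellular basis of the algebra `H` with respect to the anti-involution `σ`. -/
structure CellularBasis {𝕜 H : Type u} [Field 𝕜] [Ring H] [Algebra 𝕜 H] (σ : H →ₗ[𝕜] H) where
  Λ : Type v
  [poset : PartialOrder Λ]
  T : Λ → Type v
  [fintype : ∀ l, Fintype (T l)]
  c : Module.Basis (Σ l : Λ, T l × T l) 𝕜 H
  anti : ∀ (l : Λ) (s t : T l), σ (c ⟨l, s, t⟩) = c ⟨l, t, s⟩
  mul_right : ∀ (l : Λ) (x : H), ∃ r : T l → T l → 𝕜, ∀ s t : T l,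
    c ⟨l, s, t⟩ * x - ∑ w : T l, r t w • c ⟨l, s, w⟩ ∈
      Submodule.span 𝕜 {y | ∃ (k : Λ) (p q : T k), l < k ∧ y = c ⟨k, p, q⟩}

attribute [instance] CellularBasis.poset CellularBasis.fintype

namespace CellularBasis

variable {𝕜 H : Type u} [Field 𝕜] [Ring H] [Algebra 𝕜 H] {σ : H →ₗ[𝕜] H}

/-- The subspace `H^{▷ l}` spanned by all `c^k_{p,q}` with `k ▷ l`. -/
def above (C : CellularBasis.{u, v} σ) (l : C.Λ) : Submodule 𝕜 H :=
  Submodule.span 𝕜 {y | ∃ (k : C.Λ) (p q : C.T k), l < k ∧ y = C.c ⟨k, p, q⟩}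

/-- `M` is (isomorphic to) the left cell module `S(l)`, which has basis
`{c^l_{s,t} + H^{▷ l} | s ∈ T(l)}` for any fixed `t`: it has a basis `{b_s | s ∈ T(l)}` on which
every `x ∈ H` acts with the same coefficients. -/
def IsCellModule (C : CellularBasis.{u, v} σ) (l : C.Λ) (M : ModuleCat.{u} H) : Prop :=
  ∃ b : Module.Basis (C.T l) 𝕜 M, ∀ (x : H) (s t : C.T l),
    x * C.c ⟨l, s, t⟩ - ∑ w : C.T l, b.repr (x • b s) w • C.c ⟨l, w, t⟩ ∈ C.above l

/-- `V` has a finite filtration whose sections are the cell modules `S(k)`, `k ∈ R`, each of which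
occurs exactly once. -/
def HasMultiplicityFreeCellFiltration (C : CellularBasis.{u, v} σ) (V : ModuleCat.{u} H)
    (R : Set C.Λ) : Prop :=
  ∃ (n : ℕ) (e : Fin n ≃ R) (F : Fin (n + 1) → Submodule H V),
    F 0 = ⊥ ∧ F (Fin.last n) = ⊤ ∧ ∀ k : Fin n, F k.castSucc ≤ F k.succ ∧
      C.IsCellModule (e k)
        (ModuleCat.of H (F k.succ ⧸ (F k.castSucc).submoduleOf (F k.succ)))

end CellularBasis

/-- `V ≅ V^⊛`, where `V^⊛` is the dual space of `V` with the action `(x f)(v) = f(σ(x) v)`. -/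
def IsSelfDual {𝕜 H : Type u} [Field 𝕜] [Ring H] [Algebra 𝕜 H] (σ : H →ₗ[𝕜] H)
    (V : ModuleCat.{u} H) : Prop :=
  ∃ e : V ≃ₗ[𝕜] Module.Dual 𝕜 V, ∀ (x : H) (v w : V), e (x • v) w = e v (σ x • w)

end WeaklyTriangular

open WeaklyTriangular

/-! The heart of the matter is that `A` splits into layers. Let `below t` be the two-sided ideal
generated by the `1_c` with `c < t`. If every such ideal has a unit, in the locally unital sense
that each `1_a A 1_a` contains an element acting as the identity on it from both sides, then these
units are central, and the differences of consecutive ones are central orthogonal idempotents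
(`LayerUnits.layer`) with sum `1_a` in weight `a`. The layer `t` is generated by its part of weight
`t`, whose endomorphism algebra is `Ā_t`. Hence every `A`-module is the direct sum of its layers,
and by a Morita argument the layer `t` is the standardization of its part of weight `t`. This makes
`Δ` an equivalence (`delta_isEquivalence`), and simple modules and projective covers over `Ā_m`
standardize to simple modules and projective covers over `A`.

The units come from the dots. Call `1_a A 1_s` modulo `below s` the layer `s` in weight `a`. In
weight `a + 1` it has two parts: the diagrams whose last top strand runs through to the bottom
(`through`), and modulo these the diagrams whose last top strand is the right end of a cup
(`bendLast`); that nothing else occurs is what the bases of `A⁻` give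
(`through_sup_range_bendLast`). A dot on the last top strand slides down a through strand and then
acts by `X̄`, so its eigenvalues lie in `𝕀₀`; along a cup it turns into the dual dot, so its
eigenvalues lie in `𝕀₀♯`. Since the two sets are disjoint, a polynomial in the dot separates the
parts (`exists_through_projection`).

On the through part the remaining strands show the layer `s - 1` in weight `a`, on the cup part the
layer `s + 1`. Induction on `a` therefore produces an operator that is the identity on the layers `s
< t` and zero on the layers `s ≥ t` (`exists_layer_projection`). Taking powers turns it into an
honest left unit of `below t` (`exists_left_unit`), and the involution `σ` turns left units into
right units (`nonempty_layerUnits`). -/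

namespace WeaklyTriangular

/-! ### Sliding dots over cups -/

namespace StrandCategory

variable {𝕜 : Type u} [Field 𝕜] {P : StrandCategory 𝕜}

/-- If `x` on the left of a cap equals `y` on its right, then `x` on the right of a cup equals `y`
on its left. -/
theorem Generators.cup_slide (G : P.Generators) {x y : P.Hom 1 1}
    (h : P.comp G.cap (P.tensor x (P.id 1) : P.Hom 2 2) =
      P.comp G.cap (P.tensor (P.id 1) y : P.Hom 2 2)) :
    P.comp (P.tensor (P.id 1) x : P.Hom 2 2) G.cup =
      P.comp (P.tensor y (P.id 1) : P.Hom 2 2) G.cup := by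
  have id2 : (P.tensor (P.id 1) (P.id 1) : P.Hom 2 2) = P.id 2 := P.tensor_id 1 1
  -- `y` in terms of `x`
  have hy : y = P.comp (P.tensor (P.id 1) (P.comp G.cap (P.tensor x (P.id 1) : P.Hom 2 2)) :
      P.Hom 3 1) (P.tensor G.cup (P.id 1) : P.Hom 1 3) := by
    have e1 : (P.tensor (P.id 1) (P.comp G.cap (P.tensor (P.id 1) y : P.Hom 2 2)) : P.Hom 3 1) =
        P.comp (P.tensor (P.id 1) G.cap : P.Hom 3 1)
          (P.tensor (P.id 1) (P.tensor (P.id 1) y : P.Hom 2 2) : P.Hom 3 3) := by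
      rw [← P.tensor_comp, P.id_comp]
    have e2 : (P.tensor (P.id 1) (P.tensor (P.id 1) y : P.Hom 2 2) : P.Hom 3 3) =
        (P.tensor (P.id 2) y : P.Hom 3 3) := by
      rw [← id2]
      exact (eq_of_heq (P.tensor_assoc (P.id 1) (P.id 1) y)).symm
    have e3 : P.comp (P.tensor (P.id 2) y : P.Hom 3 3) (P.tensor G.cup (P.id 1) : P.Hom 1 3) =
        P.comp (P.tensor G.cup (P.id 1) : P.Hom 1 3) y := by
      have e5 : (P.tensor (P.id 0) y : P.Hom 1 1) = y := eq_of_heq (P.unit_tensor y)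
      conv_rhs => rw [← e5]
      have a := P.tensor_comp (P.id 2) G.cup y (P.id 1)
      have b := P.tensor_comp G.cup (P.id 0) (P.id 1) y
      rw [P.id_comp, P.comp_id] at a b
      exact a.symm.trans b
    rw [h, e1, e2, P.comp_assoc, e3, ← P.comp_assoc, G.zigzag_left, P.id_comp]
  -- With a strand added on the right, the expression of `y` through `x` can be followed by a second
  -- cup, whose zig-zag will straighten the cap again.
  have e6 : (P.tensor y (P.id 1) : P.Hom 2 2) = P.comp
      (P.tensor (P.id 1) (P.tensor (P.comp G.cap (P.tensor x (P.id 1) : P.Hom 2 2)) (P.id 1) :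
        P.Hom 3 1) : P.Hom 4 2) (P.tensor G.cup (P.id 2) : P.Hom 2 4) := by
    have a := P.tensor_comp (P.tensor (P.id 1) (P.comp G.cap (P.tensor x (P.id 1) : P.Hom 2 2)) :
      P.Hom 3 1) (P.tensor G.cup (P.id 1) : P.Hom 1 3) (P.id 1) (P.id 1)
    rw [← hy, P.id_comp] at a
    refine a.trans ?_
    have b : (P.tensor (P.tensor G.cup (P.id 1) : P.Hom 1 3) (P.id 1) : P.Hom 2 4) =
        P.tensor G.cup (P.id 2) := by
      rw [← id2]
      exact eq_of_heq (P.tensor_assoc G.cup (P.id 1) (P.id 1))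
    have c := eq_of_heq (P.tensor_assoc (P.id 1)
      (P.comp G.cap (P.tensor x (P.id 1) : P.Hom 2 2)) (P.id 1))
    exact congrArg₂ (fun f g => P.comp f g) c b
  -- Both sides are two cups side by side, created in opposite orders.
  have e7 : P.comp (P.tensor G.cup (P.id 2) : P.Hom 2 4) G.cup =
      P.comp (P.tensor (P.id 1) (P.tensor (P.id 1) G.cup : P.Hom 1 3) : P.Hom 2 4) G.cup := by
    have a := P.tensor_comp G.cup (P.id 0) (P.id 2) G.cup
    have b := P.tensor_comp (P.id 2) G.cup G.cup (P.id 0)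
    rw [P.id_comp, P.comp_id] at a b
    have c : (P.tensor (P.id 0) G.cup : P.Hom 0 2) = G.cup := eq_of_heq (P.unit_tensor G.cup)
    have d : (P.tensor G.cup (P.id 0) : P.Hom 0 2) = G.cup := P.tensor_unit G.cup
    have e : (P.tensor (P.id 1) (P.tensor (P.id 1) G.cup : P.Hom 1 3) : P.Hom 2 4) =
        P.tensor (P.id 2) G.cup := by
      rw [← id2]
      exact (eq_of_heq (P.tensor_assoc (P.id 1) (P.id 1) G.cup)).symm
    rw [e]
    have a' := (congrArg (fun t => P.comp (P.tensor G.cup (P.id 2) : P.Hom 2 4) t) c).symm.trans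
      a.symm
    have b' := b.trans (congrArg (fun t => P.comp (P.tensor (P.id 2) G.cup : P.Hom 2 4) t) d)
    exact a'.trans b'
  have e8 : P.comp (P.tensor (P.comp G.cap (P.tensor x (P.id 1) : P.Hom 2 2)) (P.id 1) : P.Hom 3 1)
      (P.tensor (P.id 1) G.cup : P.Hom 1 3) = x := by
    have a := P.tensor_comp G.cap (P.tensor x (P.id 1) : P.Hom 2 2) (P.id 1) (P.id 1)
    rw [P.id_comp] at a
    have b : (P.tensor (P.tensor x (P.id 1) : P.Hom 2 2) (P.id 1) : P.Hom 3 3) =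
        P.tensor x (P.id 2) := by
      rw [← id2]
      exact eq_of_heq (P.tensor_assoc x (P.id 1) (P.id 1))
    have c := P.tensor_comp x (P.id 1) (P.id 2) G.cup
    have d := P.tensor_comp (P.id 1) x G.cup (P.id 0)
    rw [P.id_comp, P.comp_id] at c d
    have f : (P.tensor x (P.id 0) : P.Hom 1 1) = x := P.tensor_unit x
    have g : P.comp (P.tensor x (P.id 2) : P.Hom 3 3) (P.tensor (P.id 1) G.cup : P.Hom 1 3) =
        P.comp (P.tensor (P.id 1) G.cup : P.Hom 1 3) x :=
      (c.symm.trans d).trans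
        (congrArg (fun t => P.comp (P.tensor (P.id 1) G.cup : P.Hom 1 3) t) f)
    have a' : (P.tensor (P.comp G.cap (P.tensor x (P.id 1) : P.Hom 2 2)) (P.id 1) : P.Hom 3 1) =
        P.comp (P.tensor G.cap (P.id 1) : P.Hom 3 1) (P.tensor x (P.id 2) : P.Hom 3 3) :=
      a.trans (congrArg (fun t => P.comp (P.tensor G.cap (P.id 1) : P.Hom 3 1) t) b)
    rw [a', P.comp_assoc, g, ← P.comp_assoc, G.zigzag_right, P.id_comp]
  rw [e6, P.comp_assoc, e7, ← P.comp_assoc]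
  have e9 := P.tensor_comp (P.id 1) (P.id 1)
    (P.tensor (P.comp G.cap (P.tensor x (P.id 1) : P.Hom 2 2)) (P.id 1) : P.Hom 3 1)
    (P.tensor (P.id 1) G.cup : P.Hom 1 3)
  rw [P.id_comp, e8] at e9
  exact congrArg (fun t => P.comp t G.cup) e9

/-- Some `y`, a version of the dot, slides over the cup: a dot on the right of a cup equals `y` on
its left. For the first kind `y = -dot`, for the second kind `y = dot⁻¹`. -/
theorem Generators.Relations.exists_slide {G : P.Generators} {kind : Kind}
    (hG : G.Relations kind) : ∃ y : P.Hom 1 1,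
      (kind = Kind.first → y = -G.dot) ∧ (kind = Kind.second → P.comp G.dot y = P.id 1) ∧
      P.comp (P.tensor (P.id 1) G.dot : P.Hom 2 2) G.cup =
        P.comp (P.tensor y (P.id 1) : P.Hom 2 2) G.cup := by
  cases kind with
  | first =>
    refine ⟨-G.dot, fun _ => rfl, fun h => (nomatch h), G.cup_slide ?_⟩
    rw [map_neg, map_neg]
    exact hG
  | second =>
    obtain ⟨y, h1, -, h2⟩ := hG
    exact ⟨y, fun h => (nomatch h), fun _ => h1, G.cup_slide h2⟩

end StrandCategory

theorem aeval_mulLeft_one {𝕜 R : Type*} [CommRing 𝕜] [Ring R] [Algebra 𝕜 R] (y : R)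
    (p : Polynomial 𝕜) : Polynomial.aeval (LinearMap.mulLeft 𝕜 y) p 1 = Polynomial.aeval y p := by
  have h := congrArg (fun T => T 1) (Polynomial.aeval_algHom_apply (Algebra.lmul 𝕜 R) y p)
  exact h.trans (_root_.mul_one _)

/-! ### The filtration of a locally unital algebra by the ideals of the smaller idempotents -/

namespace LUAlg

variable {𝕜 : Type u} [Field 𝕜] (B : LUAlg 𝕜)

/-- The component `1_a I 1_b` of the ideal `I` generated by the idempotents `1_c` with `c < t`. -/
def below (t a b : ℕ) : Submodule 𝕜 (B.E a b) := (B.idempotentIdeal {c | c < t}).carrier a b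

variable {B}

theorem mul_mem_below {t a b c : ℕ} (x : B.E a b) {y : B.E b c} (hy : y ∈ B.below t b c) :
    B.mul x y ∈ B.below t a c := (B.idempotentIdeal _).mul_left x hy

theorem below_mul_mem {t a b c : ℕ} {x : B.E a b} (y : B.E b c) (hx : x ∈ B.below t a b) :
    B.mul x y ∈ B.below t a c := (B.idempotentIdeal _).mul_right y hx

theorem mul_mem_below_of_lt {t a b c : ℕ} (hb : b < t) (x : B.E a b) (y : B.E b c) :
    B.mul x y ∈ B.below t a c := Submodule.subset_span ⟨b, hb, x, y, rfl⟩

theorem mem_below_of_lt_left {t a b : ℕ} (h : a < t) (x : B.E a b) : x ∈ B.below t a b := by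
  rw [← B.one_mul x]
  exact mul_mem_below_of_lt h _ _

theorem below_induction {t a b : ℕ} {p : B.E a b → Prop} (hmul : ∀ c, c < t →
    ∀ (f : B.E a c) (g : B.E c b), p (B.mul f g)) (h0 : p 0) (hadd : ∀ x y, p x → p y → p (x + y))
    (hsmul : ∀ (r : 𝕜) x, p x → p (r • x)) {x : B.E a b} (hx : x ∈ B.below t a b) : p x := by
  change x ∈ Submodule.span 𝕜 _ at hx
  induction hx using Submodule.span_induction with
  | mem x hx =>
    obtain ⟨c, hc, f, g, rfl⟩ := hx
    exact hmul c hc f g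
  | zero => exact h0
  | add x y _ _ h₁ h₂ => exact hadd x y h₁ h₂
  | smul r x _ h => exact hsmul r x h

theorem below_le {t a b : ℕ} {N : Submodule 𝕜 (B.E a b)} (h : ∀ c, c < t →
    ∀ (f : B.E a c) (g : B.E c b), B.mul f g ∈ N) : B.below t a b ≤ N := fun _ hx =>
  below_induction (p := (· ∈ N)) h N.zero_mem (fun _ _ => N.add_mem) (fun r _ => N.smul_mem r) hx

theorem below_mono {s t : ℕ} (h : s ≤ t) (a b : ℕ) : B.below s a b ≤ B.below t a b :=
  below_le fun _ hc f g => mul_mem_below_of_lt (hc.trans_le h) f g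

theorem below_zero (a b : ℕ) : B.below 0 a b = ⊥ :=
  le_bot_iff.1 (below_le fun _ hc => absurd hc (Nat.not_lt_zero _))

theorem one_def (a : ℕ) : (1 : B.E a a) = B.one a := rfl

theorem mul_one' {a b : ℕ} (x : B.E a b) : B.mul x (1 : B.E b b) = x := B.mul_one x

theorem one_mul' {a b : ℕ} (x : B.E a b) : B.mul (1 : B.E a a) x = x := B.one_mul x

theorem mul_mul {a b : ℕ} (x y : B.E a a) (z : B.E a b) :
    B.mul (x * y) z = B.mul x (B.mul y z) := B.mul_assoc x y z

theorem sub_mul' {a b c : ℕ} (x y : B.E a b) (z : B.E b c) :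
    B.mul (x - y) z = B.mul x z - B.mul y z := by rw [map_sub, LinearMap.sub_apply]

theorem add_mul' {a b c : ℕ} (x y : B.E a b) (z : B.E b c) :
    B.mul (x + y) z = B.mul x z + B.mul y z := by rw [map_add, LinearMap.add_apply]

theorem mul_smul_left {a b c : ℕ} (r : 𝕜) (x : B.E a b) (z : B.E b c) :
    B.mul (r • x) z = r • B.mul x z := by rw [map_smul, LinearMap.smul_apply]

theorem zero_mul' {a b c : ℕ} (z : B.E b c) : B.mul (0 : B.E a b) z = 0 := by
  rw [map_zero, LinearMap.zero_apply]

/-- An intertwiner of left multiplication by `x` and an endomorphism `T` also intertwines all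
polynomials in them. -/
theorem aeval_mul_of_intertwine {V : Type u} [AddCommGroup V] [Module 𝕜 V] {a b : ℕ} {x : B.E a a}
    {T : V →ₗ[𝕜] V} {φ : V →ₗ[𝕜] B.E a b} (h : ∀ v, B.mul x (φ v) = φ (T v))
    (p : Polynomial 𝕜) (v : V) :
    B.mul (Polynomial.aeval x p) (φ v) = φ (Polynomial.aeval T p v) := by
  induction p using Polynomial.induction_on' generalizing v with
  | add p q hp hq => simp only [map_add, LinearMap.add_apply, hp, hq]
  | monomial n r =>
    rw [Polynomial.aeval_monomial, Polynomial.aeval_monomial, ← Algebra.smul_def,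
      ← Algebra.smul_def, mul_smul_left, LinearMap.smul_apply, map_smul]
    congr 1
    induction n generalizing v with
    | zero => rw [pow_zero, one_mul', pow_zero, Module.End.one_apply]
    | succ n ih => rw [pow_succ, mul_mul, h, ih, pow_succ, Module.End.mul_apply]

theorem aeval_mul_comm {a b : ℕ} {x : B.E a a} {y : B.E b b} {f : B.E a b}
    (h : B.mul x f = B.mul f y) (p : Polynomial 𝕜) :
    B.mul (Polynomial.aeval x p) f = B.mul f (Polynomial.aeval y p) := by
  -- Multiplication by `f` intertwines the left multiplications by `y` and `x`; evaluating at `1`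
  -- turns the operator polynomial back into an element.
  have h1 := aeval_mul_of_intertwine (x := x) (T := LinearMap.mulLeft 𝕜 y) (φ := B.mul f)
    (fun v => by rw [← B.mul_assoc, h, B.mul_assoc]; rfl) p 1
  rw [mul_one'] at h1
  rw [h1]
  congr 1
  exact aeval_mulLeft_one y p

/-- The right multiplication by a polynomial in `y`. -/
theorem aeval_mulRight_apply {a b : ℕ} (y : B.E b b) (p : Polynomial 𝕜) (f : B.E a b) :
    Polynomial.aeval (B.mul.flip y : B.E a b →ₗ[𝕜] B.E a b) p f =
      B.mul f (Polynomial.aeval y p) := by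
  induction p using Polynomial.induction_on' generalizing f with
  | add p q hp hq => simp only [map_add, LinearMap.add_apply, hp, hq]
  | monomial n r =>
    rw [Polynomial.aeval_monomial, Polynomial.aeval_monomial, ← Algebra.smul_def,
      ← Algebra.smul_def, LinearMap.smul_apply, map_smul]
    congr 1
    induction n generalizing f with
    | zero => rw [pow_zero, pow_zero, mul_one', Module.End.one_apply]
    | succ n ih =>
      rw [pow_succ, Module.End.mul_apply, ih, LinearMap.flip_apply, pow_succ', B.mul_assoc]
      rfl

end LUAlg

/-! ### Left units from operators that separate the layers -/

namespace LUAlg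

variable {𝕜 : Type u} [Field 𝕜] {B : LUAlg 𝕜}

/-- Each factor `e` removes the highest layer: a product through `1_c` with `c` at the top of the
filtration drops by the assumption on `e`, while the smaller ones already lie lower. -/
theorem pow_mul_mem_below {a t : ℕ} {e : B.E a a}
    (he : ∀ s, t ≤ s → ∀ f : B.E a s, B.mul e f ∈ B.below s a s) (n b : ℕ) {x : B.E a b}
    (hx : x ∈ B.below (t + n) a b) : B.mul (e ^ n) x ∈ B.below t a b := by
  induction n generalizing x with
  | zero => rw [pow_zero, one_mul']; exact hx
  | succ n ih =>
    rw [pow_succ, mul_mul]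
    refine ih ?_
    refine below_induction (p := fun x => B.mul e x ∈ B.below (t + n) a b) ?_ ?_ ?_ ?_ hx
    · intro c hc f g
      rw [← B.mul_assoc]
      rcases Nat.lt_or_ge c (t + n) with h | h
      · exact mul_mem_below_of_lt h _ _
      · obtain rfl : c = t + n := by omega
        exact below_mul_mem g (he _ (by omega) f)
    · rw [map_zero]; exact zero_mem _
    · intro x y hx hy; rw [map_add]; exact add_mem hx hy
    · intro r x hx; rw [map_smul]; exact Submodule.smul_mem _ r hx

/-- Since `e` is the identity on each layer below `t`, the factor `1 - e` lowers the filtration by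
one step, and the filtration of `below t` has `t` steps. -/
theorem one_sub_pow_mul_eq_zero {a t : ℕ} {e : B.E a a}
    (he : ∀ s, s < t → ∀ f : B.E a s, B.mul e f - f ∈ B.below s a s) (b : ℕ) {x : B.E a b}
    (hx : x ∈ B.below t a b) : B.mul ((1 - e) ^ t) x = 0 := by
  induction t generalizing x with
  | zero =>
    rw [below_zero, Submodule.mem_bot] at hx
    rw [hx, map_zero]
  | succ t ih =>
    rw [pow_succ, mul_mul]
    refine ih (fun s hs => he s (by omega)) ?_
    refine below_induction (p := fun x => B.mul (1 - e) x ∈ B.below t a b) ?_ ?_ ?_ ?_ hx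
    · intro c hc f g
      rw [← B.mul_assoc]
      rcases Nat.lt_or_ge c t with h | h
      · exact mul_mem_below_of_lt h _ _
      · obtain rfl : c = t := by omega
        refine below_mul_mem g ?_
        rw [sub_mul', one_mul', ← neg_mem_iff, neg_sub]
        exact he _ (by omega) f
    · rw [map_zero]; exact zero_mem _
    · intro x y hx hy; rw [map_add]; exact add_mem hx hy
    · intro r x hx; rw [map_smul]; exact Submodule.smul_mem _ r hx

/-- An element of `1_a B 1_a` that acts as the identity on the layers `s < t` of `B` and as zero on
the layers `s ≥ t` can be improved to a left unit of the ideal generated by the `1_c`, `c < t`. -/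
theorem exists_left_unit {a t : ℕ} {e : B.E a a}
    (h₁ : ∀ s, s < t → ∀ f : B.E a s, B.mul e f - f ∈ B.below s a s)
    (h₂ : ∀ s, t ≤ s → ∀ f : B.E a s, B.mul e f ∈ B.below s a s) :
    ∃ ε ∈ B.below t a a, ∀ (b : ℕ), ∀ f ∈ B.below t a b, B.mul ε f = f := by
  -- All of `1_a B 1_a` lies in `below (a + 1)`, so `a + 1` factors `e` suffice to reach `below t`.
  -- The outer power kills the error on `below t`, because `1 - e ^ (a + 1)` is a multiple of `1 -
  -- e`; the constant terms cancel, so `e ^ (a + 1)` still divides the result.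
  refine ⟨1 - (1 - e ^ (a + 1)) ^ t, ?_, ?_⟩
  · obtain ⟨y, hy⟩ : e ^ (a + 1) ∣ 1 - (1 - e ^ (a + 1)) ^ t := by
      have h := (Commute.one_left (1 - e ^ (a + 1))).sub_dvd_pow_sub_pow t
      rwa [sub_sub_cancel, one_pow] at h
    rw [hy]
    refine below_mul_mem y ?_
    rw [← mul_one' (e ^ (a + 1))]
    exact pow_mul_mem_below h₂ _ _ (mem_below_of_lt_left (by omega) _)
  · intro b f hf
    rw [sub_mul', one_mul', sub_eq_self]
    have h : (1 - e ^ (a + 1)) = (∑ i ∈ Finset.range (a + 1), e ^ i) * (1 - e) := by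
      rw [geom_sum_mul_neg]
    have hc : Commute (∑ i ∈ Finset.range (a + 1), e ^ i) (1 - e) :=
      (Commute.one_right _).sub_right
        (Commute.sum_left _ _ _ fun i _ => (Commute.refl e).pow_left i)
    rw [h, hc.mul_pow, mul_mul, one_sub_pow_mul_eq_zero h₁ b hf, map_zero]

end LUAlg

/-! ### Dots and cups on the last strands -/

namespace StrandCategory

namespace RightTensorIdeal

open LUAlg

variable {𝕜 : Type u} [Field 𝕜] {P : StrandCategory 𝕜} (K : P.RightTensorIdeal)

/-- The image in `A` of `1_m ⊗ y`, where `y` is an endomorphism of the generating object. -/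
def lastStrand (m : ℕ) (y : P.Hom 1 1) : K.alg.E (m + 1) (m + 1) :=
  K.proj (P.tensor (P.id m) y : P.Hom (m + 1) (m + 1))

/-- The image in `A` of `1_m ⊗ cup`. -/
def lastCup (G : P.Generators) (m : ℕ) : K.alg.E (m + 2) m :=
  K.proj (P.tensor (P.id m) G.cup : P.Hom m (m + 2))

/-- The interchange law: `y` sits on the added strand and slides along it past `f`. -/
theorem lastStrand_mul_tau {a b : ℕ} (y : P.Hom 1 1) (f : K.alg.E a b) :
    K.alg.mul (K.lastStrand a y) (K.tau f) = K.alg.mul (K.tau f) (K.lastStrand b y) := by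
  obtain ⟨f, rfl⟩ := K.proj_surjective f
  rw [lastStrand, lastStrand, tau_proj, proj_mul, proj_mul]
  congr 1
  have h₁ := P.tensor_comp (P.id a) f y (P.id 1)
  have h₂ := P.tensor_comp f (P.id b) (P.id 1) y
  rw [P.id_comp, P.comp_id] at h₁ h₂
  exact h₁.symm.trans h₂

theorem tau_tau_mul_lastCup (G : P.Generators) {a b : ℕ} (f : K.alg.E a b) :
    K.alg.mul (K.tau (K.tau f)) (K.lastCup G b) = K.alg.mul (K.lastCup G a) f := by
  obtain ⟨f, rfl⟩ := K.proj_surjective f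
  rw [lastCup, lastCup, tau_proj, tau_proj, proj_mul, proj_mul]
  congr 1
  have h₁ := P.tensor_comp f (P.id b) (P.id 2) G.cup
  have h₂ := P.tensor_comp (P.id a) f G.cup (P.id 0)
  rw [P.id_comp, P.comp_id] at h₁ h₂
  have h₃ : (P.tensor (P.tensor f (P.id 1)) (P.id 1) : P.Hom (b + 2) (a + 2)) =
      P.tensor f (P.id 2) := by
    rw [← P.tensor_id 1 1]
    exact eq_of_heq (P.tensor_assoc f (P.id 1) (P.id 1))
  have h₄ : P.tensor f (P.id 0) = f := P.tensor_unit f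
  exact (congrArg (fun t => P.comp t (P.tensor (P.id b) G.cup)) h₃).trans
    ((h₁.symm.trans h₂).trans (congrArg (fun t => P.comp (P.tensor (P.id a) G.cup) t) h₄))

theorem lastStrand_mul_lastCup {G : P.Generators} {x y : P.Hom 1 1}
    (h : P.comp (P.tensor (P.id 1) x : P.Hom 2 2) G.cup =
      P.comp (P.tensor y (P.id 1) : P.Hom 2 2) G.cup) (m : ℕ) :
    K.alg.mul (K.lastStrand (m + 1) x) (K.lastCup G m) =
      K.alg.mul (K.tau (K.lastStrand m y)) (K.lastCup G m) := by
  rw [lastCup, lastStrand, lastStrand, tau_proj, proj_mul, proj_mul]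
  congr 1
  have h₁ := P.tensor_comp (P.id m) (P.id m) (P.tensor (P.id 1) x : P.Hom 2 2) G.cup
  have h₂ := P.tensor_comp (P.id m) (P.id m) (P.tensor y (P.id 1) : P.Hom 2 2) G.cup
  rw [h] at h₁
  have h₃ : (P.tensor (P.id (m + 1)) x : P.Hom (m + 2) (m + 2)) =
      P.tensor (P.id m) (P.tensor (P.id 1) x : P.Hom 2 2) := by
    rw [← P.tensor_id m 1]
    exact eq_of_heq (P.tensor_assoc (P.id m) (P.id 1) x)
  have h₄ : (P.tensor (P.tensor (P.id m) y) (P.id 1) : P.Hom (m + 2) (m + 2)) =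
      P.tensor (P.id m) (P.tensor y (P.id 1) : P.Hom 2 2) :=
    eq_of_heq (P.tensor_assoc (P.id m) y (P.id 1))
  exact (congrArg (fun t => P.comp t (P.tensor (P.id m) G.cup)) h₃).trans
    ((h₁.symm.trans h₂).trans (congrArg (fun t => P.comp t (P.tensor (P.id m) G.cup)) h₄.symm))

theorem tau_mem_below {t a b : ℕ} {x : K.alg.E a b} (hx : x ∈ K.alg.below t a b) :
    K.tau x ∈ K.alg.below (t + 1) (a + 1) (b + 1) := by
  refine below_induction (p := fun x => K.tau x ∈ K.alg.below (t + 1) (a + 1) (b + 1))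
    ?_ ?_ ?_ ?_ hx
  · intro c hc f g
    rw [tau_mul]
    exact mul_mem_below_of_lt (by omega) _ _
  · rw [map_zero]; exact zero_mem _
  · intro x y hx hy; rw [map_add]; exact add_mem hx hy
  · intro r x hx; rw [map_smul]; exact Submodule.smul_mem _ r hx

/-! ### The bottom layer of the branching of a standard bimodule -/

/-- The part of `1_{a+1} A 1_s` in which the last strand on top is a through strand, modulo the
smaller layers. -/
def through (a : ℕ) : ∀ s : ℕ, Submodule 𝕜 (K.alg.E (a + 1) s)
  | 0 => ⊥
  | m + 1 => Submodule.span 𝕜 {z | ∃ (y : K.alg.E a m) (h : K.alg.E (m + 1) (m + 1)),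
      z = K.alg.mul (K.tau y) h} ⊔ K.alg.below (m + 1) (a + 1) (m + 1)

theorem below_le_through (a s : ℕ) : K.alg.below s (a + 1) s ≤ K.through a s := by
  cases s with
  | zero => rw [below_zero]; exact bot_le
  | succ m => exact le_sup_right

theorem tau_mul_mem_through {a m : ℕ} (y : K.alg.E a m) (h : K.alg.E (m + 1) (m + 1)) :
    K.alg.mul (K.tau y) h ∈ K.through a (m + 1) :=
  Submodule.mem_sup_left (Submodule.subset_span ⟨y, h, rfl⟩)

theorem through_succ_le {a m : ℕ} {N : Submodule 𝕜 (K.alg.E (a + 1) (m + 1))}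
    (hbelow : K.alg.below (m + 1) (a + 1) (m + 1) ≤ N)
    (hgen : ∀ (y : K.alg.E a m) (h : K.alg.E (m + 1) (m + 1)), K.alg.mul (K.tau y) h ∈ N) :
    K.through a (m + 1) ≤ N := by
  refine sup_le (Submodule.span_le.2 ?_) hbelow
  rintro _ ⟨y, h, rfl⟩
  exact hgen y h

theorem tau_mul_through {a s : ℕ} (p : K.alg.E a a) {x : K.alg.E (a + 1) s}
    (hx : x ∈ K.through a s) : K.alg.mul (K.tau p) x ∈ K.through a s := by
  cases s with
  | zero => rw [(Submodule.mem_bot 𝕜).1 hx, map_zero]; exact zero_mem _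
  | succ m =>
    refine K.through_succ_le (N := (K.through a (m + 1)).comap (K.alg.mul (K.tau p))) ?_ ?_ hx
    · exact fun x hx => K.below_le_through _ _ (mul_mem_below _ hx)
    · intro y h
      rw [Submodule.mem_comap, ← K.alg.mul_assoc, ← tau_mul]
      exact K.tau_mul_mem_through _ _

/-- Bending the last strand at the bottom of a morphism to the top. -/
def bendLast (G : P.Generators) (a s : ℕ) : K.alg.E a (s + 1) →ₗ[𝕜] K.alg.E (a + 1) s :=
  (K.alg.mul.flip (K.lastCup G s)).comp K.tau

theorem bendLast_apply (G : P.Generators) {a s : ℕ} (f : K.alg.E a (s + 1)) :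
    K.bendLast G a s f = K.alg.mul (K.tau f) (K.lastCup G s) := rfl

theorem tau_mul_bendLast (G : P.Generators) {a s : ℕ} (p : K.alg.E a a) (f : K.alg.E a (s + 1)) :
    K.alg.mul (K.tau p) (K.bendLast G a s f) = K.bendLast G a s (K.alg.mul p f) := by
  rw [bendLast_apply, bendLast_apply, tau_mul, K.alg.mul_assoc]

/-- The dot slides down the last strand, over the cup, and comes out as right multiplication at the
bottom of `f`. Eigenvalues on the cup part are thereby reduced to those of `y` on the last strand in
weight `s + 1`. -/
theorem lastStrand_mul_bendLast {G : P.Generators} {x y : P.Hom 1 1}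
    (h : P.comp (P.tensor (P.id 1) x : P.Hom 2 2) G.cup =
      P.comp (P.tensor y (P.id 1) : P.Hom 2 2) G.cup) {a s : ℕ} (f : K.alg.E a (s + 1)) :
    K.alg.mul (K.lastStrand a x) (K.bendLast G a s f) =
      K.bendLast G a s (K.alg.mul.flip (K.lastStrand s y) f) := by
  rw [bendLast_apply, bendLast_apply, ← K.alg.mul_assoc, lastStrand_mul_tau, K.alg.mul_assoc,
    K.lastStrand_mul_lastCup h, LinearMap.flip_apply, tau_mul, K.alg.mul_assoc]

end RightTensorIdeal
end StrandCategory

/-! ### Consequences of a weakly triangular decomposition -/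

namespace WeaklyTriangularDecomposition

variable {𝕜 : Type u} [Field 𝕜] {B : LUAlg 𝕜}

/-- Only the surjectivity of the multiplication map `B⁻ ⊗ B° ⊗ B⁺ → B` is used: triangular products
span. -/
theorem mem_of_forall_mul_mem (W : WeaklyTriangularDecomposition B) {a c : ℕ}
    {N : Submodule 𝕜 (B.E a c)}
    (h : ∀ b, ∀ x ∈ W.neg a b, ∀ y ∈ W.circ b, ∀ z ∈ W.pos b c, B.mul (B.mul x y) z ∈ N)
    (w : B.E a c) : w ∈ N := by
  obtain ⟨d, rfl⟩ := (W.bijective a c).2 w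
  induction d using DirectSum.induction_on with
  | zero => rw [map_zero]; exact zero_mem _
  | add d e hd he => rw [map_add]; exact add_mem hd he
  | of b t =>
    erw [DirectSum.toModule_lof]
    induction t using TensorProduct.induction_on with
    | zero => rw [map_zero]; exact zero_mem _
    | add d e hd he => rw [map_add]; exact add_mem hd he
    | tmul s z =>
      induction s using TensorProduct.induction_on with
      | zero => rw [TensorProduct.zero_tmul, map_zero]; exact zero_mem _
      | add d e hd he => rw [TensorProduct.add_tmul, map_add]; exact add_mem hd he
      | tmul x y => exact h b x x.2 y y.2 z z.2

/-- The components of the algebra between idempotents of different parity vanish. -/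
theorem eq_zero_of_odd (W : WeaklyTriangularDecomposition B) {a b : ℕ}
    (hab : ¬ Even (a + b)) (w : B.E a b) : w = 0 := by
  refine (Submodule.mem_bot 𝕜).1 (W.mem_of_forall_mul_mem ?_ w)
  intro c x hx y hy z hz
  rw [Submodule.mem_bot]
  by_cases hac : Prec a c
  · by_cases hbc : Prec b c
    · obtain ⟨s, rfl⟩ := hac
      obtain ⟨t, rfl⟩ := hbc
      exact absurd ⟨c + s + t, by ring⟩ hab
    · rw [W.pos_eq_bot _ _ hbc, Submodule.mem_bot] at hz
      rw [hz, map_zero]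
  · rw [W.neg_eq_bot _ _ hac, Submodule.mem_bot] at hx
    rw [hx, map_zero, LinearMap.zero_apply, map_zero, LinearMap.zero_apply]

/-- An index `c ⋠ m` is either smaller than `m` or of the other parity, and in the latter case there
are no morphisms between `c` and `m`. This lets the truncation order be replaced by the linear order
of `ℕ`. -/
theorem notPrecIdeal_carrier (W : WeaklyTriangularDecomposition B) (m b : ℕ) :
    (B.notPrecIdeal m).carrier b m = B.below m b m := by
  refine le_antisymm (Submodule.span_le.2 ?_) (LUAlg.below_le fun c hc f g => ?_)
  · rintro _ ⟨c, hc, f, g, rfl⟩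
    rcases Nat.lt_or_ge c m with h | h
    · exact LUAlg.mul_mem_below_of_lt h f g
    · have hodd : ¬ Even (c + m) := by
        rintro ⟨s, hs⟩
        exact hc ⟨s - m, by omega⟩
      rw [W.eq_zero_of_odd hodd g, map_zero]
      exact zero_mem _
  · refine Submodule.subset_span ⟨c, ?_, f, g, rfl⟩
    rintro ⟨s, rfl⟩
    omega

end WeaklyTriangularDecomposition

/-! ### Splitting a layer according to the last strand on top. -/

namespace StrandCategory

namespace RightTensorIdeal

open LUAlg

variable {𝕜 : Type u} [Field 𝕜] {P : StrandCategory 𝕜} (K : P.RightTensorIdeal)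

/-- If `f` factors through `c ≤ s`, its bent version factors through `c + 1`. For `c = s` parity
makes the morphism zero, for `c = s - 1` the last strand becomes a through strand, and for smaller
`c` the result lies in `below s`. So bending is well defined from the layer `s + 1` to the layer `s`
modulo the through part. -/
theorem bendLast_mem_through (W : WeaklyTriangularDecomposition K.alg) (G : P.Generators)
    {a s : ℕ} {f : K.alg.E a (s + 1)} (hf : f ∈ K.alg.below (s + 1) a (s + 1)) :
    K.bendLast G a s f ∈ K.through a s := by
  refine below_le (N := (K.through a s).comap (K.bendLast G a s)) (fun c hc f g => ?_) hf
  rw [Submodule.mem_comap, bendLast_apply, tau_mul, K.alg.mul_assoc]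
  rcases Nat.lt_or_ge (c + 1) s with h | h
  · exact K.below_le_through _ _ (mul_mem_below_of_lt h _ _)
  · rcases Nat.lt_or_ge c s with h' | h'
    · obtain rfl : s = c + 1 := by omega
      exact K.tau_mul_mem_through _ _
    · obtain rfl : c = s := by omega
      have hodd : ¬ Even (c + (c + 1)) := by
        rintro ⟨s, hs⟩
        omega
      rw [W.eq_zero_of_odd hodd g, map_zero, map_zero, LinearMap.zero_apply, map_zero]
      exact zero_mem _

/-- Every morphism decomposes into a part in which the last strand on top is a through strand, and
a part in which it is the right end of a cup. -/
theorem through_sup_range_bendLast {G : P.Generators} {W : WeaklyTriangularDecomposition K.alg}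
    {S : W.Bases} {D : ∀ m : ℕ, Set (K.alg.E (m + 1) (m + 1))} (hS : K.CompatibleBases G S D)
    {a s : ℕ} (w : K.alg.E (a + 1) s) :
    w ∈ K.through a s ⊔ LinearMap.range (K.bendLast G a s) := by
  refine W.mem_of_forall_mul_mem ?_ w
  intro b x hx y hy z hz
  by_cases hb : Prec s b
  swap
  · rw [W.pos_eq_bot _ _ hb, Submodule.mem_bot] at hz
    rw [hz, map_zero]
    exact zero_mem _
  obtain ⟨n, rfl⟩ := hb
  -- Products through `b < s` lie in `below s`; for `b = s` the factor from `A⁺` is a scalar.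
  rcases Nat.eq_zero_or_pos n with rfl | hn
  swap
  · exact Submodule.mem_sup_left (K.below_le_through _ _ (mul_mem_below_of_lt (by omega) _ _))
  change z ∈ W.pos b b at hz
  rw [W.pos_self, Submodule.mem_span_singleton] at hz
  obtain ⟨r, rfl⟩ := hz
  change _ ∈ K.through a b ⊔ LinearMap.range (K.bendLast G a b)
  rw [map_smul]
  refine Submodule.smul_mem _ r ?_
  rw [K.alg.mul_one]
  have hbend : ∀ (f : K.alg.E a (b + 1)) (d : K.alg.E (b + 1) (b + 1)),
      K.alg.mul (K.bend G f d) y ∈ LinearMap.range (K.bendLast G a b) := by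
    intro f d
    -- The diagram `y` below the cup is pulled up past it, where it appears as `y ⊗ 1 ⊗ 1`.
    refine ⟨K.alg.mul (K.alg.mul f d) (K.tau y), ?_⟩
    rw [bendLast_apply, tau_mul, tau_mul, K.alg.mul_assoc, tau_tau_mul_lastCup, ← K.alg.mul_assoc,
      K.alg.mul_assoc (K.tau f)]
    rfl
  cases b with
  | zero =>
    rw [← (hS.Y_zero a).2] at hx
    refine (Submodule.span_le (p := (K.through a 0 ⊔ LinearMap.range (K.bendLast G a 0)).comap
      (K.alg.mul.flip y))).2 ?_ hx
    rintro _ ⟨⟨f, d⟩, rfl⟩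
    exact Submodule.mem_sup_right (hbend _ _)
  | succ m =>
    rw [← (hS.Y_succ m a).2] at hx
    refine (Submodule.span_le (p := (K.through a (m + 1) ⊔
      LinearMap.range (K.bendLast G a (m + 1))).comap (K.alg.mul.flip y))).2 ?_ hx
    rintro _ ⟨f | ⟨f, d⟩, rfl⟩
    · exact Submodule.mem_sup_left (K.tau_mul_mem_through _ _)
    · exact Submodule.mem_sup_right (hbend _ _)

end RightTensorIdeal
end StrandCategory

/-! ### The quotient maps onto the algebras `B̄_m`. -/

namespace LUAlg

/-- The projection `B_m → B̄_m` as an algebra homomorphism. -/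
def barHom {𝕜 : Type u} [Field 𝕜] (B : LUAlg 𝕜) (m : ℕ) : B.E m m →ₐ[𝕜] B.Bar m :=
  AlgHom.ofLinearMap (B.toTrunc m m m) rfl (fun _ _ => rfl)

theorem barHom_surjective {𝕜 : Type u} [Field 𝕜] (B : LUAlg 𝕜) (m : ℕ) :
    Function.Surjective (B.barHom m) := Submodule.mkQ_surjective _

theorem toTrunc_eq_zero {𝕜 : Type u} [Field 𝕜] (B : LUAlg 𝕜) {m a b : ℕ} {x : B.E a b} :
    B.toTrunc m a b x = 0 ↔ x ∈ (B.notPrecIdeal m).carrier a b :=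
  Submodule.Quotient.mk_eq_zero _

end LUAlg

namespace StrandCategory

namespace RightTensorIdeal

open _root_.WeaklyTriangular.LUAlg hiding mul_assoc one_mul mul_one
open Polynomial

variable {𝕜 : Type u} [Field 𝕜] {P : StrandCategory 𝕜} (K : P.RightTensorIdeal)

/-! ### Eigenvalues of dots -/

/-- The multiplication `x ⊗ v ↦ x ι(v)` respects the balancing relations and sends `z ⊗ v₀` to `z`,
so this tensor does not vanish. -/
theorem nontrivial_iRes (G : P.Generators) {m : ℕ} {i : 𝕜} {z : K.Abar (m + 1)} (hz : z ≠ 0)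
    (hmem : z ∈ K.resBimodule G m i) (V : ModuleCat.{u} (K.Abar (m + 1)))
    (ι : V →ₗ[K.Abar (m + 1)] K.Abar (m + 1)) {v₀ : V} (hv₀ : ι v₀ = 1) :
    Nontrivial (K.iRes G m i V) := by
  have hι : ∀ (c : 𝕜) (v : V), ι (c • v) = c • ι v := fun c v => by
    rw [← algebraMap_smul (K.Abar (m + 1)) c v, map_smul, smul_eq_mul, Algebra.smul_def]
  refine nontrivial_of_ne (Submodule.Quotient.mk ((⟨z, hmem⟩ : K.resBimodule G m i) ⊗ₜ[𝕜] v₀)) 0 ?_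
  intro h0
  have h1 := (Submodule.Quotient.mk_eq_zero _).1 h0
  let μ : (K.resBimodule G m i) ⊗[𝕜] V →ₗ[𝕜] K.Abar (m + 1) :=
    TensorProduct.lift (LinearMap.mk₂ 𝕜 (fun (x : K.resBimodule G m i) (v : V) => x.1 * ι v)
      (fun x y v => add_mul x.1 y.1 _) (fun c x v => smul_mul_assoc c x.1 _)
      (fun x v w => by rw [map_add, mul_add]) (fun c x v => by rw [hι, mul_smul_comm]))
  have hμ : ∀ (x : K.resBimodule G m i) (v : V),
      μ (x ⊗ₜ[𝕜] v) = x.1 * ι v := fun x v => rfl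
  -- The balancing relations generate an `Ā_m`-submodule, so linearity of `μ` over `𝕜` alone would
  -- not suffice.
  have hsmul : ∀ (r : K.Abar m) (t : (K.resBimodule G m i) ⊗[𝕜] V),
      μ (r • t) = K.tauBar m r * μ t := by
    intro r t
    induction t using TensorProduct.induction_on with
    | zero => rw [smul_zero, map_zero, mul_zero]
    | add x y hx hy => rw [smul_add, map_add, hx, hy, map_add, mul_add]
    | tmul x v => rw [TensorProduct.smul_tmul', hμ, hμ, ← mul_assoc]; rfl
  have h2 : ∀ t ∈ balancing 𝕜 (K.Abar m) (V := V) (K.resRight G m i), μ t = 0 := by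
    intro t ht
    induction ht using Submodule.span_induction with
    | mem t ht =>
      obtain ⟨x, r, v, rfl⟩ := ht
      rw [map_sub, hμ, hμ, map_smul, smul_eq_mul, ← mul_assoc, sub_eq_zero]
      rfl
    | zero => exact map_zero _
    | add x y _ _ hx hy => rw [map_add, hx, hy, add_zero]
    | smul r t _ h => rw [hsmul, h, mul_zero]
  have h3 := h2 _ h1
  rw [hμ, hv₀, mul_one] at h3
  exact hz h3

/-- Applying `Ē_i` to the regular module gives the generalized eigenspace itself, which contains
`z`. -/
theorem mem_I₀ (G : P.Generators) {m : ℕ} {i : 𝕜} {z : K.Abar (m + 1)} (hz : z ≠ 0)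
    (h : K.dotBar G m * z = i • z) : i ∈ K.I₀ G := by
  have hmem : z ∈ K.resBimodule G m i := by
    change z ∈ Module.End.maxGenEigenspace (LinearMap.mulLeft 𝕜 (K.dotBar G m)) i
    refine Module.End.mem_maxGenEigenspace _ _ _ |>.2 ⟨1, ?_⟩
    rw [pow_one, LinearMap.sub_apply, LinearMap.mulLeft_apply, h, LinearMap.smul_apply,
      Module.End.one_apply, sub_self]
  exact ⟨m, ModuleCat.of _ (K.Abar (m + 1)),
    K.nontrivial_iRes G hz hmem (ModuleCat.of _ (K.Abar (m + 1))) LinearMap.id (v₀ := 1) rfl⟩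

/-- A polynomial whose roots are eigenvalues of `x` and which annihilates `x` modulo the smaller
layers. -/
theorem exists_aeval_mem_below (W : WeaklyTriangularDecomposition K.alg)
    [∀ a b : ℕ, FiniteDimensional 𝕜 (K.alg.E a b)] {m : ℕ} (x : K.alg.E m m) :
    ∃ p : 𝕜[X], aeval x p ∈ K.alg.below m m m ∧ ∀ i, p.eval i = 0 →
      ∃ z : K.Abar m, z ≠ 0 ∧ K.alg.barHom m x * z = i • z := by
  have : FiniteDimensional 𝕜 (K.Abar m) :=
    Module.Finite.of_surjective (K.toBar m) (K.toBar_surjective m)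
  -- The minimal polynomial is taken of the operator of left multiplication on `Ā_m`, so that each
  -- root has an eigenvector in `Ā_m`; evaluating the operator at `1` shows that it annihilates the
  -- element as well.
  refine ⟨minpoly 𝕜 (LinearMap.mulLeft 𝕜 (K.alg.barHom m x)), ?_, fun i hi => ?_⟩
  · rw [← W.notPrecIdeal_carrier, ← toTrunc_eq_zero]
    change K.alg.barHom m _ = 0
    rw [← aeval_algHom_apply, ← aeval_mulLeft_one, minpoly.aeval, LinearMap.zero_apply]
  · obtain ⟨z, hz⟩ := (Module.End.hasEigenvalue_of_isRoot hi).exists_hasEigenvector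
    exact ⟨z, hz.2, hz.apply_eq_smul⟩

variable {K}

theorem exists_dot_polynomial (W : WeaklyTriangularDecomposition K.alg)
    [∀ a b : ℕ, FiniteDimensional 𝕜 (K.alg.E a b)] (G : P.Generators) (m : ℕ) :
    ∃ p : 𝕜[X], aeval (K.lastStrand m G.dot) p ∈ K.alg.below (m + 1) (m + 1) (m + 1) ∧
      ∀ i, p.eval i = 0 → i ∈ K.I₀ G := by
  obtain ⟨p, hp, hroot⟩ := K.exists_aeval_mem_below W (K.lastStrand m G.dot)
  refine ⟨p, hp, fun i hi => ?_⟩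
  obtain ⟨z, hz, h⟩ := hroot i hi
  exact K.mem_I₀ G hz h

/-- An eigenvector of `y` with eigenvalue `i` is an eigenvector of the dot with eigenvalue `-i` in
the first kind and `i⁻¹` in the second, and `♯` is an involution. -/
theorem exists_slide_polynomial (W : WeaklyTriangularDecomposition K.alg)
    [∀ a b : ℕ, FiniteDimensional 𝕜 (K.alg.E a b)] {G : P.Generators} {kind : Kind} {y : P.Hom 1 1}
    (hy₁ : kind = Kind.first → y = -G.dot)
    (hy₂ : kind = Kind.second → P.comp G.dot y = P.id 1) (m : ℕ) :
    ∃ p : 𝕜[X], aeval (K.lastStrand m y) p ∈ K.alg.below (m + 1) (m + 1) (m + 1) ∧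
      ∀ i, p.eval i = 0 → i ∈ sharp kind '' K.I₀ G := by
  obtain ⟨p, hp, hroot⟩ := K.exists_aeval_mem_below W (K.lastStrand m y)
  refine ⟨p, hp, fun i hi => ?_⟩
  obtain ⟨z, hz, h⟩ := hroot i hi
  cases kind with
  | first =>
    refine ⟨-i, K.mem_I₀ G hz ?_, neg_neg i⟩
    have e : K.alg.barHom (m + 1) (K.lastStrand m y) = -K.dotBar G m := by
      rw [lastStrand, hy₁ rfl, map_neg, map_neg, map_neg]
      rfl
    rw [e, neg_mul] at h
    rw [neg_smul, ← h, neg_neg]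
  | second =>
    have e : K.dotBar G m * K.alg.barHom (m + 1) (K.lastStrand m y) = 1 := by
      have h1 : K.alg.mul (K.lastStrand m G.dot) (K.lastStrand m y) = K.alg.one (m + 1) := by
        rw [lastStrand, lastStrand, proj_mul, ← P.tensor_comp, hy₂ rfl, P.id_comp, P.tensor_id]
        rfl
      exact congrArg (K.toBar (m + 1)) h1
    -- Multiplying the eigenvalue equation of `y` by `X̄` both excludes `i = 0` and exhibits `i⁻¹`
    -- as an eigenvalue of `X̄`.
    have e' : z = i • (K.dotBar G m * z) := by
      rw [← mul_smul_comm, ← h, ← mul_assoc, e, one_mul]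
    have hi0 : i ≠ 0 := by
      rintro rfl
      rw [zero_smul] at e'
      exact hz e'
    refine ⟨i⁻¹, K.mem_I₀ G hz ?_, inv_inv i⟩
    conv_rhs => rw [e', smul_smul, inv_mul_cancel₀ hi0, one_smul]

/-! ### Separating the layers -/

/-- There is an operator which acts as the identity on the through part and as zero on the
complementary part of every layer. -/
theorem exists_through_projection [IsAlgClosed 𝕜] {kind : Kind} {G : P.Generators}
    (hG : G.Relations kind) (hfin : ∀ a b : ℕ, FiniteDimensional 𝕜 (K.alg.E a b))
    (W : WeaklyTriangularDecomposition K.alg) (hI : K.I₀ G ∩ sharp kind '' K.I₀ G = ∅) (a : ℕ) :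
    ∃ u : K.alg.E (a + 1) (a + 1), ∀ s, s ≤ a + 1 →
      (∀ x ∈ K.through a s, K.alg.mul u x - x ∈ K.alg.below s (a + 1) s) ∧
      (∀ f, K.alg.mul u (K.bendLast G a s f) ∈ K.through a s) := by
  obtain ⟨y, hy₁, hy₂, hslide⟩ := hG.exists_slide
  choose p hp hproot using fun m => exists_dot_polynomial W G m
  choose q hq hqroot using fun m => exists_slide_polynomial W hy₁ hy₂ m
  -- One operator has to serve all layers `s ≤ a + 1`, hence the products: the layer `s` needs `p (s
  -- - 1)` and `q s`, so the range goes up to `a + 1`. A common root would lie in `𝕀₀ ∩ 𝕀₀♯`.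
  have hcop : IsCoprime (∏ m ∈ Finset.range (a + 2), p m) (∏ m ∈ Finset.range (a + 2), q m) := by
    rw [Polynomial.isCoprime_iff_aeval_ne_zero_of_isAlgClosed 𝕜 𝕜]
    intro i
    by_contra! h
    rw [coe_aeval_eq_eval, eval_prod, eval_prod, Finset.prod_eq_zero_iff,
      Finset.prod_eq_zero_iff] at h
    obtain ⟨⟨m, -, hm⟩, ⟨n, -, hn⟩⟩ := h
    have : i ∈ K.I₀ G ∩ sharp kind '' K.I₀ G := ⟨hproot m i hm, hqroot n i hn⟩
    rw [hI] at this
    exact this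
  obtain ⟨α, β, hαβ⟩ := hcop
  have hbelow : ∀ (m : ℕ) (r : 𝕜[X]) (x : K.alg.E (m + 1) (m + 1)), ∀ g : 𝕜[X],
      aeval x g ∈ K.alg.below (m + 1) (m + 1) (m + 1) → g ∣ r →
      aeval x r ∈ K.alg.below (m + 1) (m + 1) (m + 1) := by
    rintro m _ x g hg ⟨r, rfl⟩
    rw [map_mul]
    exact below_mul_mem _ hg
  -- By Bézout this polynomial is `1` modulo the product of the `p m`, which annihilates the through
  -- part, and `0` modulo the product of the `q m`, which annihilates the cup part modulo the
  -- through part.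
  refine ⟨aeval (K.lastStrand a G.dot) (β * ∏ m ∈ Finset.range (a + 2), q m), fun s hs => ⟨?_, ?_⟩⟩
  · have e : (β * ∏ m ∈ Finset.range (a + 2), q m) =
        1 - α * ∏ m ∈ Finset.range (a + 2), p m := by
      rw [← hαβ]; ring
    intro x hx
    rw [e, map_sub, map_one, sub_mul', one_mul', sub_sub_cancel_left, neg_mem_iff]
    cases s with
    | zero => rw [(Submodule.mem_bot 𝕜).1 hx, map_zero]; exact zero_mem _
    | succ m =>
      refine K.through_succ_le (N := (K.alg.below (m + 1) (a + 1) (m + 1)).comap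
        (K.alg.mul (aeval (K.lastStrand a G.dot) _))) ?_ ?_ hx
      · exact fun x hx => mul_mem_below _ hx
      · intro f h
        rw [Submodule.mem_comap, ← K.alg.mul_assoc,
          aeval_mul_comm (K.lastStrand_mul_tau G.dot f), K.alg.mul_assoc]
        refine mul_mem_below _ (below_mul_mem _ (hbelow m _ _ (p m) (hp m) ?_))
        exact Dvd.dvd.mul_left (Finset.dvd_prod_of_mem _ (Finset.mem_range.2 (by omega))) _
  · intro f
    rw [aeval_mul_of_intertwine (fun f => K.lastStrand_mul_bendLast hslide f),
      aeval_mulRight_apply]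
    refine K.bendLast_mem_through W G (mul_mem_below _ (hbelow s _ _ (q s) (hq s) ?_))
    exact Dvd.dvd.mul_left (Finset.dvd_prod_of_mem _ (Finset.mem_range.2 (by omega))) _

/-- There is an operator which acts as the identity on the layers `s < t` and as zero on the layers
`s ≥ t`. -/
theorem exists_layer_projection [IsAlgClosed 𝕜] {kind : Kind} {G : P.Generators}
    (hG : G.Relations kind) (hfin : ∀ a b : ℕ, FiniteDimensional 𝕜 (K.alg.E a b))
    {W : WeaklyTriangularDecomposition K.alg} {S : W.Bases}
    {D : ∀ m : ℕ, Set (K.alg.E (m + 1) (m + 1))} (hS : K.CompatibleBases G S D)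
    (hI : K.I₀ G ∩ sharp kind '' K.I₀ G = ∅) (a t : ℕ) :
    ∃ e : K.alg.E a a,
      (∀ s, s < t → ∀ f : K.alg.E a s, K.alg.mul e f - f ∈ K.alg.below s a s) ∧
      (∀ s, t ≤ s → ∀ f : K.alg.E a s, K.alg.mul e f ∈ K.alg.below s a s) := by
  induction a generalizing t with
  | zero =>
    cases t with
    | zero =>
      exact ⟨0, fun s hs => absurd hs (Nat.not_lt_zero s),
        fun s _ f => by rw [zero_mul']; exact zero_mem _⟩
    | succ t =>
      -- In weight `0` only the layer `0` is nonzero, and it lies below the threshold.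
      exact ⟨1, fun s _ f => by rw [one_mul', sub_self]; exact zero_mem _,
        fun s hs f => mem_below_of_lt_left (by omega) _⟩
  | succ a ih =>
    cases t with
    | zero =>
      exact ⟨0, fun s hs => absurd hs (Nat.not_lt_zero s),
        fun s _ f => by rw [zero_mul']; exact zero_mem _⟩
    | succ t =>
      obtain ⟨u, hu⟩ := exists_through_projection hG hfin W hI a
      -- The through part of the layer `s` comes from the layer `s - 1` in weight `a` and the cup
      -- part from the layer `s + 1`. The condition `s < t + 1` becomes `s - 1 < t` on the former
      -- and `s + 1 < t + 2` on the latter, which gives the thresholds for `p` and `q`; `u` then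
      -- selects which of them acts.
      obtain ⟨p, hp₁, hp₂⟩ := ih t
      obtain ⟨q, hq₁, hq₂⟩ := ih (t + 2)
      set e : K.alg.E (a + 1) (a + 1) := K.tau p * u + K.tau q * (1 - u) with he
      -- the action of `e` on the two parts of a layer
      have hN : ∀ s, s ≤ a + 1 → ∀ x ∈ K.through a s,
          K.alg.mul e x - K.alg.mul (K.tau p) x ∈ K.alg.below s (a + 1) s := by
        intro s hs x hx
        have h : K.alg.mul e x - K.alg.mul (K.tau p) x =
            K.alg.mul (K.tau p - K.tau q) (K.alg.mul u x - x) := by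
          rw [he, add_mul', mul_mul, mul_mul, sub_mul', sub_mul', one_mul']
          simp only [map_sub]
          abel
        rw [h]
        exact mul_mem_below _ ((hu s hs).1 x hx)
      have hC : ∀ s, s ≤ a + 1 → ∀ f, K.alg.mul e (K.bendLast G a s f) -
          K.bendLast G a s (K.alg.mul q f) ∈ K.through a s := by
        intro s hs f
        have h : K.alg.mul e (K.bendLast G a s f) - K.bendLast G a s (K.alg.mul q f) =
            K.alg.mul (K.tau p) (K.alg.mul u (K.bendLast G a s f)) -
            K.alg.mul (K.tau q) (K.alg.mul u (K.bendLast G a s f)) := by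
          rw [he, add_mul', mul_mul, mul_mul, sub_mul', one_mul', map_sub, tau_mul_bendLast]
          abel
        rw [h]
        exact sub_mem (K.tau_mul_through p ((hu s hs).2 f)) (K.tau_mul_through q ((hu s hs).2 f))
      have hp : ∀ m, ∀ (c : 𝕜), (∀ f : K.alg.E a m, K.alg.mul p f - c • f ∈ K.alg.below m a m) →
          ∀ x ∈ K.through a (m + 1),
            K.alg.mul (K.tau p) x - c • x ∈ K.alg.below (m + 1) (a + 1) (m + 1) := by
        -- The scalar `c` will be `1` or `0`, so that the layers on the two sides of the threshold
        -- are treated at once.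
        intro m c hc x hx
        let T : K.alg.E (a + 1) (m + 1) →ₗ[𝕜] K.alg.E (a + 1) (m + 1) :=
          K.alg.mul (K.tau p) - c • LinearMap.id
        refine K.through_succ_le (N := (K.alg.below (m + 1) (a + 1) (m + 1)).comap T) ?_ ?_ hx
        · intro x hx
          exact sub_mem (mul_mem_below _ hx) (Submodule.smul_mem _ c hx)
        · intro f h
          have h' : T (K.alg.mul (K.tau f) h) =
              K.alg.mul (K.tau (K.alg.mul p f - c • f)) h := by
            rw [map_sub, sub_mul', tau_mul, map_smul, mul_smul_left, K.alg.mul_assoc]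
            rfl
          rw [Submodule.mem_comap, h']
          exact below_mul_mem _ (K.tau_mem_below (hc f))
      -- `e` acts as a scalar `c` on the two parts of a layer
      have hscalar : ∀ s, s ≤ a + 1 → ∀ c : 𝕜,
          (∀ m, s = m + 1 → ∀ f : K.alg.E a m, K.alg.mul p f - c • f ∈ K.alg.below m a m) →
          (∀ f : K.alg.E a (s + 1), K.alg.mul q f - c • f ∈ K.alg.below (s + 1) a (s + 1)) →
          ∀ f : K.alg.E (a + 1) s, K.alg.mul ((e - algebraMap 𝕜 _ c) ^ 2) f ∈
            K.alg.below s (a + 1) s := by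
        intro s hs c hpc hqc f
        have halg : ∀ g : K.alg.E (a + 1) s, K.alg.mul (e - algebraMap 𝕜 _ c) g =
            K.alg.mul e g - c • g := by
          intro g
          rw [sub_mul', Algebra.algebraMap_eq_smul_one, mul_smul_left, one_mul']
        have h1 : ∀ x ∈ K.through a s, K.alg.mul (e - algebraMap 𝕜 _ c) x ∈
            K.alg.below s (a + 1) s := by
          intro x hx
          rw [halg, ← sub_add_sub_cancel _ (K.alg.mul (K.tau p) x)]
          refine add_mem (hN s hs x hx) ?_
          cases s with
          | zero =>
            rw [(Submodule.mem_bot 𝕜).1 hx, map_zero, smul_zero, sub_zero]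
            exact zero_mem _
          | succ m => exact hp m c (hpc m rfl) x hx
        -- The layer has the two-step filtration by its through part, and `e - c` lowers it by one
        -- step; hence the square.
        rw [sq, mul_mul]
        refine h1 _ ?_
        obtain ⟨x, hx, _, ⟨g, rfl⟩, rfl⟩ := Submodule.mem_sup.1 (K.through_sup_range_bendLast hS f)
        rw [map_add]
        refine add_mem (K.below_le_through _ _ (h1 x hx)) ?_
        rw [halg, ← sub_add_sub_cancel _ (K.bendLast G a s (K.alg.mul q g))]
        refine add_mem (hC s hs g) ?_
        rw [← map_smul, ← map_sub]
        exact K.bendLast_mem_through W G (hqc g)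
      have h₀ : ∀ s, t + 1 ≤ s → ∀ f : K.alg.E (a + 1) s,
          K.alg.mul (e ^ 2) f ∈ K.alg.below s (a + 1) s := by
        intro s hs f
        rcases Nat.lt_or_ge (a + 1) s with h | h
        · exact mem_below_of_lt_left h _
        · have := hscalar s h 0 (fun m hm f => by
            rw [zero_smul, sub_zero]; exact hp₂ m (by omega) f) (fun f => by
            rw [zero_smul, sub_zero]; exact hq₂ (s + 1) (by omega) f) f
          rwa [map_zero, sub_zero] at this
      have h₁ : ∀ s, s < t + 1 → ∀ f : K.alg.E (a + 1) s,
          K.alg.mul ((e - 1) ^ 2) f ∈ K.alg.below s (a + 1) s := by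
        intro s hs f
        rcases Nat.lt_or_ge (a + 1) s with h | h
        · exact mem_below_of_lt_left h _
        · have := hscalar s h 1 (fun m hm f => by
            rw [one_smul]; exact hp₁ m (by omega) f) (fun f => by
            rw [one_smul]; exact hq₁ (s + 1) (by omega) f) f
          rwa [map_one] at this
      -- As `e` is only known to have generalized eigenvalue `0` or `1` on each layer, with exponent
      -- two, it is replaced by `1 - (1 - e ^ 2) ^ 2`. This is divisible by `e ^ 2`, and its
      -- difference from `1` is divisible by `(e - 1) ^ 2`.
      refine ⟨(2 - e ^ 2) * e ^ 2, fun s hs f => ?_, fun s hs f => ?_⟩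
      · have h : (2 - e ^ 2) * e ^ 2 = 1 - (e + 1) ^ 2 * (e - 1) ^ 2 := by
          noncomm_ring
        rw [h, sub_mul', one_mul', sub_sub_cancel_left, neg_mem_iff, mul_mul]
        exact mul_mem_below _ (h₁ s hs f)
      · rw [mul_mul]
        exact mul_mem_below _ (h₀ s hs f)

/-! ### Units of the layers -/

theorem Involution.onAlg_onAlg (σ : K.Involution) {a b : ℕ} (x : K.alg.E a b) :
    σ.onAlg (σ.onAlg x) = x := by
  obtain ⟨x, rfl⟩ := K.proj_surjective x
  exact congrArg K.proj (σ.map_map x)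

theorem Involution.onAlg_mem_below (σ : K.Involution) {t a b : ℕ} {x : K.alg.E a b}
    (hx : x ∈ K.alg.below t a b) : σ.onAlg x ∈ K.alg.below t b a :=
  below_le (N := (K.alg.below t b a).comap σ.onAlg) (fun c hc f g => by
    rw [Submodule.mem_comap, σ.onAlg_mul]
    exact mul_mem_below_of_lt hc _ _) hx

end RightTensorIdeal
end StrandCategory

/-- The ideals of `B` generated by the idempotents `1_c`, `c < t`, have units. -/
structure LUAlg.LayerUnits {𝕜 : Type u} [Field 𝕜] (B : LUAlg 𝕜) where
  /-- The component in `1_a B 1_a` of the unit of the ideal generated by the `1_c`, `c < t`. -/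
  unit : ℕ → ∀ a : ℕ, B.E a a
  mem : ∀ t a : ℕ, unit t a ∈ B.below t a a
  unit_mul : ∀ {t a b : ℕ} {f : B.E a b}, f ∈ B.below t a b → B.mul (unit t a) f = f
  mul_unit : ∀ {t a b : ℕ} {f : B.E b a}, f ∈ B.below t b a → B.mul f (unit t a) = f
  notPrec : ∀ m b : ℕ, (B.notPrecIdeal m).carrier b m = B.below m b m

namespace StrandCategory.RightTensorIdeal

open _root_.WeaklyTriangular.LUAlg hiding mul_assoc one_mul mul_one

variable {𝕜 : Type u} [Field 𝕜] {P : StrandCategory 𝕜} {K : P.RightTensorIdeal}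

/-- The involution preserves each ideal `below t` and reverses products, so it carries the left unit
to a right unit. A left unit and a right unit, both in the ideal, coincide. -/
theorem nonempty_layerUnits [IsAlgClosed 𝕜] {kind : Kind} {G : P.Generators}
    (hG : G.Relations kind) (hfin : ∀ a b : ℕ, FiniteDimensional 𝕜 (K.alg.E a b))
    {W : WeaklyTriangularDecomposition K.alg} {S : W.Bases}
    {D : ∀ m : ℕ, Set (K.alg.E (m + 1) (m + 1))} (hS : K.CompatibleBases G S D)
    (σ : K.Involution) (hI : K.I₀ G ∩ sharp kind '' K.I₀ G = ∅) : Nonempty K.alg.LayerUnits := by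
  have h : ∀ t a : ℕ, ∃ e ∈ K.alg.below t a a,
      ∀ b, ∀ f ∈ K.alg.below t a b, K.alg.mul e f = f := by
    intro t a
    obtain ⟨e, h₁, h₂⟩ := exists_layer_projection hG hfin hS hI a t
    exact exists_left_unit h₁ h₂
  choose e he hmul using h
  have hmul' : ∀ t a b, ∀ f ∈ K.alg.below t b a, K.alg.mul f (σ.onAlg (e t a)) = f := by
    intro t a b f hf
    have := congrArg σ.onAlg (hmul t a b _ (σ.onAlg_mem_below hf))
    rwa [σ.onAlg_mul, σ.onAlg_onAlg] at this
  have heq : ∀ t a, σ.onAlg (e t a) = e t a := fun t a =>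
    (hmul t a a _ (σ.onAlg_mem_below (he t a))).symm.trans (hmul' t a a _ (he t a))
  exact ⟨⟨e, he, hmul _ _ _ _, fun {t a b f} hf => heq t a ▸ hmul' t a b f hf,
    W.notPrecIdeal_carrier⟩⟩

end StrandCategory.RightTensorIdeal

namespace LUAlg

variable {𝕜 : Type u} [Field 𝕜] {B : LUAlg 𝕜}

/-! ### Monomorphisms and epimorphisms of modules -/

namespace Mod

variable {M N : B.Mod}

theorem comp_app {L : B.Mod} (φ : M ⟶ N) (ψ : N ⟶ L) (a : ℕ) (x : M.X a) :
    Hom.app (φ ≫ ψ) a x = Hom.app ψ a (Hom.app φ a x) := rfl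

theorem hom_ext {φ ψ : M ⟶ N} (h : ∀ a x, Hom.app φ a x = Hom.app ψ a x) : φ = ψ :=
  Hom.ext (funext fun a => LinearMap.ext (h a))

/-- The kernel of a homomorphism. -/
def kernel (φ : M ⟶ N) : B.Mod where
  X a := LinearMap.ker (Hom.app φ a)
  act {a b} := LinearMap.mk₂ 𝕜 (fun f x => ⟨M.act f x.1, by
      rw [LinearMap.mem_ker, Hom.comm, LinearMap.mem_ker.1 x.2, map_zero]⟩)
    (fun f g x => Subtype.ext (by simp)) (fun c f x => Subtype.ext (by simp))
    (fun f x y => Subtype.ext (by simp)) (fun c f x => Subtype.ext (by simp))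
  one_act x := Subtype.ext (M.one_act x.1)
  mul_act f g x := Subtype.ext (M.mul_act f g x.1)

/-- The inclusion of the kernel. -/
def kernelι (φ : M ⟶ N) : kernel φ ⟶ M where
  app a := (LinearMap.ker (Hom.app φ a)).subtype
  comm _ _ := rfl

/-- The cokernel of a homomorphism. -/
def cokernel (φ : M ⟶ N) : B.Mod where
  X a := N.X a ⧸ LinearMap.range (Hom.app φ a)
  act {a b} :=
    { toFun := fun f => Submodule.mapQ _ _ (N.act f) (by
        rintro _ ⟨x, rfl⟩
        exact ⟨M.act f x, Hom.comm φ f x⟩)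
      map_add' := fun f g => by
        apply Submodule.linearMap_qext
        ext x
        simp
      map_smul' := fun c f => by
        apply Submodule.linearMap_qext
        ext x
        simp }
  one_act x := by
    obtain ⟨x, rfl⟩ := Submodule.Quotient.mk_surjective _ x
    exact congrArg Submodule.Quotient.mk (N.one_act x)
  mul_act f g x := by
    obtain ⟨x, rfl⟩ := Submodule.Quotient.mk_surjective _ x
    exact congrArg Submodule.Quotient.mk (N.mul_act f g x)

/-- The projection onto the cokernel. -/
def cokernelπ (φ : M ⟶ N) : N ⟶ cokernel φ where
  app a := (LinearMap.range (Hom.app φ a)).mkQ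
  comm _ _ := rfl

/-- A monomorphism cancels from the inclusion of its kernel, which is therefore zero. -/
theorem injective_of_mono (φ : M ⟶ N) [Mono φ] (a : ℕ) : Function.Injective (Hom.app φ a) := by
  have h : kernelι φ = 0 := by
    rw [← cancel_mono φ, Limits.zero_comp]
    exact hom_ext fun a x => x.2
  rw [← LinearMap.ker_eq_bot, LinearMap.ker_eq_bot']
  intro x hx
  exact congrArg (fun ψ : kernel φ ⟶ M => Hom.app ψ a ⟨x, hx⟩) h

theorem surjective_of_epi (φ : M ⟶ N) [Epi φ] (a : ℕ) : Function.Surjective (Hom.app φ a) := by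
  have h : cokernelπ φ = 0 := by
    rw [← cancel_epi φ, Limits.comp_zero]
    exact hom_ext fun a x => (Submodule.Quotient.mk_eq_zero _).2 ⟨x, rfl⟩
  intro y
  exact (Submodule.Quotient.mk_eq_zero _).1 (congrArg (fun ψ => Hom.app ψ a y) h)

theorem epi_of_surjective (φ : M ⟶ N) (h : ∀ a, Function.Surjective (Hom.app φ a)) : Epi φ where
  left_cancellation ψ ψ' e := hom_ext fun a y => by
    obtain ⟨x, rfl⟩ := h a y
    exact congrArg (fun χ => Hom.app χ a x) e

theorem isIso_of_bijective (φ : M ⟶ N) (h : ∀ a, Function.Bijective (Hom.app φ a)) : IsIso φ := by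
  let e : ∀ a, M.X a ≃ₗ[𝕜] N.X a := fun a => LinearEquiv.ofBijective (Hom.app φ a) (h a)
  refine ⟨⟨⟨fun a => (e a).symm.toLinearMap, fun {a b} f y => ?_⟩, hom_ext fun a x => ?_,
    hom_ext fun a y => ?_⟩⟩
  · obtain ⟨x, rfl⟩ := (h b).2 y
    apply (h a).1
    rw [Hom.comm]
    exact ((e a).apply_symm_apply _).trans
      (congrArg (N.act f) (congrArg (Hom.app φ b) ((e b).symm_apply_apply x)).symm)
  · exact (e a).symm_apply_apply x
  · exact (e a).apply_symm_apply y

theorem bijective_of_isIso (φ : M ⟶ N) [IsIso φ] (a : ℕ) : Function.Bijective (Hom.app φ a) :=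
  ⟨injective_of_mono φ a, surjective_of_epi φ a⟩

/-- A homomorphism that vanishes on the kernel of an epimorphism factors through it. -/
theorem exists_factor {L : B.Mod} (φ : M ⟶ N) [Epi φ] (ψ : M ⟶ L)
    (h : ∀ a x, Hom.app φ a x = 0 → Hom.app ψ a x = 0) : ∃ χ : N ⟶ L, φ ≫ χ = ψ := by
  have hs := surjective_of_epi φ
  let χ : ∀ a, N.X a →ₗ[𝕜] L.X a := fun a =>
    ((LinearMap.ker (Hom.app φ a)).liftQ (Hom.app ψ a) (fun x hx => h a x hx)).comp
      ((Hom.app φ a).quotKerEquivOfSurjective (hs a)).symm.toLinearMap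
  have hχ : ∀ a x, χ a (Hom.app φ a x) = Hom.app ψ a x := by
    intro a x
    have e : ((Hom.app φ a).quotKerEquivOfSurjective (hs a)).symm (Hom.app φ a x) =
        Submodule.Quotient.mk x := by
      rw [LinearEquiv.symm_apply_eq]
      rfl
    exact congrArg
      ((LinearMap.ker (Hom.app φ a)).liftQ (Hom.app ψ a) (fun x hx => h a x hx)) e
  refine ⟨⟨χ, fun {a b} f y => ?_⟩, hom_ext hχ⟩
  obtain ⟨x, rfl⟩ := hs b y
  rw [← Hom.comm, hχ, hχ, Hom.comm]

/-- A nonzero homomorphism from a simple module is injective. -/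
theorem injective_of_simple [Simple M] (φ : M ⟶ N) (hφ : φ ≠ 0) (a : ℕ) :
    Function.Injective (Hom.app φ a) := by
  have hmono : Mono (kernelι φ) := ⟨fun ψ ψ' e => hom_ext fun a x =>
    Subtype.ext (congrArg (fun χ => Hom.app χ a x) e)⟩
  have h0 : kernelι φ = 0 := by
    by_contra hne
    have := isIso_of_mono_of_nonzero hne
    apply hφ
    rw [← cancel_epi (kernelι φ), Limits.comp_zero]
    exact hom_ext fun a x => x.2
  rw [← LinearMap.ker_eq_bot, LinearMap.ker_eq_bot']
  intro x hx
  exact congrArg (fun ψ : kernel φ ⟶ M => Hom.app ψ a ⟨x, hx⟩) h0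

end Mod

end LUAlg

namespace LUAlg

variable {𝕜 : Type u} [Field 𝕜] {B : LUAlg 𝕜}

/-! ### Generators of standard modules -/

section Std

variable {m : ℕ} {V W : ModuleCat.{u} (B.Bar m)}

/-- The element `f̄ ⊗ v` of the standard module `B_{⪯ m} 1̄_m ⊗ V`. -/
noncomputable def stdGen (V : ModuleCat.{u} (B.Bar m)) {b : ℕ} (f : B.E b m) (v : V) :
    ((B.std m).obj V).X b :=
  Submodule.Quotient.mk (B.toTrunc m b m f ⊗ₜ[𝕜] v)

theorem act_stdGen {a b : ℕ} (g : B.E a b) (f : B.E b m) (v : V) :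
    ((B.std m).obj V).act g (stdGen V f v) = stdGen V (B.mul g f) v := rfl

theorem act_stdGen_one {a : ℕ} (f : B.E a m) (v : V) :
    ((B.std m).obj V).act f (stdGen V (B.one m) v) = stdGen V f v := by
  rw [act_stdGen, B.mul_one]

theorem map_stdGen (φ : V ⟶ W) {b : ℕ} (f : B.E b m) (v : V) :
    Mod.Hom.app ((B.std m).map φ) b (stdGen V f v) = stdGen W f (φ.hom v) := rfl

theorem stdGen_mul {b : ℕ} (f : B.E b m) (r : B.E m m) (v : V) :
    stdGen V (B.mul f r) v = stdGen V f (B.barHom m r • v) := by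
  rw [← sub_eq_zero]
  refine (Submodule.Quotient.mk_sub _).symm.trans ((Submodule.Quotient.mk_eq_zero _).2 ?_)
  exact Submodule.subset_span ⟨B.toTrunc m b m f, B.barHom m r, v, rfl⟩

theorem stdGen_add {b : ℕ} (f : B.E b m) (v w : V) :
    stdGen V f (v + w) = stdGen V f v + stdGen V f w := by
  rw [stdGen, TensorProduct.tmul_add, Submodule.Quotient.mk_add]
  rfl

theorem stdGen_zero {b : ℕ} (f : B.E b m) : stdGen V f 0 = 0 := by
  rw [stdGen, TensorProduct.tmul_zero, Submodule.Quotient.mk_zero]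
  rfl

theorem stdGen_eq_zero {b : ℕ} {f : B.E b m} (hf : f ∈ (B.notPrecIdeal m).carrier b m) (v : V) :
    stdGen V f v = 0 := by
  rw [stdGen, B.toTrunc_eq_zero.2 hf, TensorProduct.zero_tmul, Submodule.Quotient.mk_zero]
  rfl

theorem std_induction {b : ℕ} {p : ((B.std m).obj V).X b → Prop}
    (hgen : ∀ (f : B.E b m) (v : V), p (stdGen V f v)) (hadd : ∀ x y, p x → p y → p (x + y))
    (x : ((B.std m).obj V).X b) : p x := by
  obtain ⟨x, rfl⟩ := Submodule.Quotient.mk_surjective _ x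
  induction x using TensorProduct.induction_on with
  | zero =>
    have h := hgen 0 0
    rw [stdGen_zero] at h
    exact h
  | add x y hx hy => exact hadd _ _ hx hy
  | tmul f v =>
    obtain ⟨f, rfl⟩ := Submodule.Quotient.mk_surjective _ f
    exact hgen f v

theorem exists_stdGen_one (x : ((B.std m).obj V).X m) : ∃ v, x = stdGen V (B.one m) v := by
  refine std_induction (p := fun x => ∃ v, x = stdGen V (B.one m) v) (fun f v => ⟨B.barHom m f • v, ?_⟩) ?_ x
  · rw [← stdGen_mul, B.one_mul]
  · rintro _ _ ⟨v, rfl⟩ ⟨w, rfl⟩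
    exact ⟨v + w, (stdGen_add _ _ _).symm⟩

theorem std_hom_ext {M : B.Mod} {φ ψ : (B.std m).obj V ⟶ M}
    (h : ∀ v : V, Mod.Hom.app φ m (stdGen V (B.one m) v) =
      Mod.Hom.app ψ m (stdGen V (B.one m) v)) : φ = ψ := by
  refine Mod.hom_ext fun a x => std_induction
    (p := fun x => Mod.Hom.app φ a x = Mod.Hom.app ψ a x) (fun f v => ?_) (fun x y hx hy => ?_) x
  · rw [← act_stdGen_one, Mod.Hom.comm, Mod.Hom.comm, h]
  · rw [map_add, map_add, hx, hy]

/-- The map `V → B̄_m ⊗ V`, `v ↦ 1 ⊗ v` is injective. -/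
theorem stdGen_one_injective : Function.Injective (stdGen V (B.one m)) := by
  let μ : ((B.std m).obj V).X m →ₗ[𝕜] V :=
    Submodule.liftQ _ (TensorProduct.lift (LinearMap.mk₂ 𝕜 (fun (x : B.Bar m) (v : V) => x • v)
      (fun x y v => add_smul x y v) (fun c x v => smul_assoc c x v) (fun x v w => smul_add x v w)
      (fun c x v => smul_comm x c v))) (by
      refine Submodule.span_le.2 ?_
      rintro _ ⟨x, r, v, rfl⟩
      rw [SetLike.mem_coe, LinearMap.mem_ker, map_sub, sub_eq_zero]
      exact mul_smul x r v)
  have hμ : ∀ v : V, μ (stdGen V (B.one m) v) = v := fun v => one_smul (B.Bar m) v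
  exact fun v w h => by rw [← hμ v, h, hμ]

end Std

end LUAlg

namespace LUAlg

variable {𝕜 : Type u} [Field 𝕜] {B : LUAlg 𝕜}

namespace LayerUnits

variable (U : B.LayerUnits)

/-! ### The central idempotents of the layers -/

/-- Both sides equal the product `unit * f * unit`, since the unit of an ideal absorbs on either
side. -/
theorem unit_comm {t a b : ℕ} (f : B.E a b) :
    B.mul (U.unit t a) f = B.mul f (U.unit t b) :=
  (U.mul_unit (below_mul_mem f (U.mem t a))).symm.trans
    ((B.mul_assoc _ _ _).trans (U.unit_mul (mul_mem_below f (U.mem t b))))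

theorem unit_eq_one {t a : ℕ} (h : a < t) : U.unit t a = B.one a := by
  rw [← U.unit_mul (mem_below_of_lt_left h (B.one a)), B.mul_one]

theorem unit_zero (a : ℕ) : U.unit 0 a = 0 := by
  have h := U.mem 0 a
  rwa [below_zero, Submodule.mem_bot] at h

/-- The central idempotent of the layer `t`. -/
def layer (t a : ℕ) : B.E a a := U.unit (t + 1) a - U.unit t a

theorem layer_comm {t a b : ℕ} (f : B.E a b) :
    B.mul (U.layer t a) f = B.mul f (U.layer t b) := by
  rw [layer, layer, sub_mul', map_sub, U.unit_comm, U.unit_comm]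

theorem layer_mem (t a : ℕ) : U.layer t a ∈ B.below (t + 1) a a :=
  sub_mem (U.mem _ _) (below_mono (Nat.le_succ t) _ _ (U.mem t a))

theorem layer_eq_zero {t a : ℕ} (h : a < t) : U.layer t a = 0 := by
  rw [layer, U.unit_eq_one h, U.unit_eq_one (h.trans (Nat.lt_succ_self t)), sub_self]

theorem layer_self (m : ℕ) : U.layer m m = B.one m - U.unit m m := by
  rw [layer, U.unit_eq_one (Nat.lt_succ_self m)]

theorem layer_mul_layer (t a : ℕ) : B.mul (U.layer t a) (U.layer t a) = U.layer t a := by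
  have h : B.mul (U.unit t a) (U.layer t a) = 0 := by
    rw [layer, map_sub, U.unit_mul (U.mem t a), ← U.unit_comm,
      U.unit_mul (below_mono (Nat.le_succ t) _ _ (U.mem t a)), sub_self]
  have e : B.mul (U.layer t a) (U.layer t a) =
      B.mul (U.unit (t + 1) a) (U.layer t a) - B.mul (U.unit t a) (U.layer t a) := sub_mul' _ _ _
  rw [e, h, sub_zero, U.unit_mul (U.layer_mem t a)]

theorem sum_layer (a : ℕ) : ∑ t ∈ Finset.range (a + 1), U.layer t a = B.one a := by
  have h := Finset.sum_range_sub (fun t => U.unit t a) (a + 1)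
  rwa [U.unit_zero, sub_zero, U.unit_eq_one (Nat.lt_succ_self a)] at h

/-- The layer idempotent lies in `below (t + 1)` and equals its own square. Inserting the second
copy into products through `1_c` kills those with `c < t` by centrality, and leaves those through
`1_t`. -/
theorem layer_mem_span (t a : ℕ) : U.layer t a ∈ Submodule.span 𝕜
    {x | ∃ (f : B.E a t) (g : B.E t a), x = B.mul f (B.mul (U.layer t t) g)} := by
  set Z : Submodule 𝕜 (B.E a a) := Submodule.span 𝕜
    {x | ∃ (f : B.E a t) (g : B.E t a), x = B.mul f (B.mul (U.layer t t) g)}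
  suffices h : B.below (t + 1) a a ≤ Z.comap (B.mul.flip (U.layer t a)) by
    rw [← U.layer_mul_layer]
    exact h (U.layer_mem t a)
  refine below_le fun c hc f g => ?_
  rw [Submodule.mem_comap, LinearMap.flip_apply, B.mul_assoc, ← U.layer_comm]
  rcases Nat.lt_or_ge c t with h | h
  · rw [U.layer_eq_zero h, zero_mul', map_zero]
    exact zero_mem _
  · obtain rfl : c = t := by omega
    exact Submodule.subset_span ⟨f, g, rfl⟩

section Modules

variable {M N : B.Mod}

theorem sum_act_layer {a : ℕ} (x : M.X a) :
    ∑ t ∈ Finset.range (a + 1), M.act (U.layer t a) x = x := by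
  rw [← LinearMap.sum_apply, ← map_sum, U.sum_layer, M.one_act]

/-- The layer `t` of a module is generated by its part of weight `t`. -/
theorem act_layer_mem {t a : ℕ} (x : M.X a) {Z : Submodule 𝕜 (M.X a)}
    (h : ∀ (f : B.E a t) (g : B.E t a), M.act f (M.act (U.layer t t) (M.act g x)) ∈ Z) :
    M.act (U.layer t a) x ∈ Z := by
  refine (Submodule.span_le (p := Z.comap (M.act.flip x))).2 ?_ (U.layer_mem_span t a)
  rintro _ ⟨f, g, rfl⟩
  change M.act _ x ∈ Z
  rw [M.mul_act, M.mul_act]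
  exact h f g

/-- The layer `t` of a module is detected by its part of weight `t`. -/
theorem act_layer_eq_zero {t a : ℕ} (x : M.X a)
    (h : ∀ g : B.E t a, M.act (U.layer t t) (M.act g x) = 0) : M.act (U.layer t a) x = 0 := by
  rw [← Submodule.mem_bot 𝕜]
  exact U.act_layer_mem x fun f g => by rw [h g, map_zero]; exact zero_mem _

/-! ### The layers of standard modules -/

variable {m : ℕ} {V W : ModuleCat.{u} (B.Bar m)}

theorem unit_mem_notPrec (m : ℕ) : U.unit m m ∈ (B.notPrecIdeal m).carrier m m := by
  rw [U.notPrec]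
  exact U.mem m m

/-- By centrality the idempotent can be moved to weight `m`. There it lies in the ideal divided out
if `t < m`, and is zero if `t > m`. -/
theorem act_layer_std_of_ne {t a : ℕ} (h : t ≠ m) (x : ((B.std m).obj V).X a) :
    ((B.std m).obj V).act (U.layer t a) x = 0 := by
  refine std_induction (p := fun x => ((B.std m).obj V).act (U.layer t a) x = 0) (fun f v => ?_)
    (fun x y hx hy => by rw [map_add, hx, hy, add_zero]) x
  rw [act_stdGen]
  refine stdGen_eq_zero ?_ v
  rw [U.layer_comm, U.notPrec]
  rcases Nat.lt_or_gt_of_ne h with h | h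
  · exact mul_mem_below _ (below_mono h _ _ (U.layer_mem t m))
  · rw [U.layer_eq_zero h, map_zero]
    exact zero_mem _

theorem act_layer_std {a : ℕ} (x : ((B.std m).obj V).X a) :
    ((B.std m).obj V).act (U.layer m a) x = x := by
  have h := U.sum_act_layer x
  by_cases hm : m < a + 1
  · rwa [Finset.sum_eq_single_of_mem m (Finset.mem_range.2 hm)
      (fun t _ ht => U.act_layer_std_of_ne ht x)] at h
  · rw [Finset.sum_eq_zero fun t ht => U.act_layer_std_of_ne
      (by have := Finset.mem_range.1 ht; omega) x] at h
    rw [← h, map_zero]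

/-- An element of a standard module vanishes if all its images of weight `m` do. -/
theorem std_eq_zero (U : B.LayerUnits) {a : ℕ} (x : ((B.std m).obj V).X a)
    (h : ∀ g : B.E m a, ((B.std m).obj V).act g x = 0) : x = 0 := by
  rw [← U.act_layer_std x]
  exact U.act_layer_eq_zero x fun g => by rw [h g, map_zero]

/-! ### The right adjoint of the standardization functors -/

/-- The part of weight `m` of the layer `m` of a module. -/
def core (m : ℕ) (M : B.Mod) : Submodule 𝕜 (M.X m) := LinearMap.ker (M.act (U.unit m m))

theorem mem_core {x : M.X m} : x ∈ U.core m M ↔ M.act (U.unit m m) x = 0 := LinearMap.mem_ker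

theorem act_layer_mem_core (x : M.X m) : M.act (U.layer m m) x ∈ U.core m M := by
  rw [mem_core, ← M.mul_act, layer_self, map_sub, B.mul_one, U.unit_mul (U.mem m m), sub_self,
    map_zero, LinearMap.zero_apply]

theorem act_layer_of_mem_core {x : M.X m} (hx : x ∈ U.core m M) : M.act (U.layer m m) x = x := by
  rw [layer_self, map_sub, LinearMap.sub_apply, U.mem_core.1 hx, sub_zero, M.one_act]

theorem act_eq_zero_of_mem_core {b : ℕ} {f : B.E b m} (hf : f ∈ (B.notPrecIdeal m).carrier b m)
    {x : M.X m} (hx : x ∈ U.core m M) : M.act f x = 0 := by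
  rw [U.notPrec] at hf
  rw [← U.mul_unit hf, M.mul_act, U.mem_core.1 hx, map_zero]

theorem act_mem_core (f : B.E m m) {x : M.X m} (hx : x ∈ U.core m M) : M.act f x ∈ U.core m M := by
  rw [mem_core, ← M.mul_act, U.unit_comm, M.mul_act, U.mem_core.1 hx, map_zero]

theorem app_mem_core (φ : M ⟶ N) {x : M.X m} (hx : x ∈ U.core m M) :
    Mod.Hom.app φ m x ∈ U.core m N := by
  rw [mem_core, ← Mod.Hom.comm, U.mem_core.1 hx, map_zero]

theorem stdGen_one_mem_core (v : V) : stdGen V (B.one m) v ∈ U.core m ((B.std m).obj V) := by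
  rw [mem_core, act_stdGen, B.mul_one, stdGen_eq_zero (U.unit_mem_notPrec m)]

/-- The action of `B̄_m` on the core. -/
def coreAct (m : ℕ) (M : B.Mod) : B.Bar m →ₗ[𝕜] U.core m M →ₗ[𝕜] U.core m M :=
  Submodule.liftQ _ (LinearMap.mk₂ 𝕜 (fun (f : B.E m m) x =>
      (⟨M.act f x.1, U.act_mem_core f x.2⟩ : U.core m M))
    (fun f g x => Subtype.ext (by simp)) (fun c f x => Subtype.ext (by simp))
    (fun f x y => Subtype.ext (by simp)) (fun c f x => Subtype.ext (by simp)))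
    (fun f hf => LinearMap.ext fun x => Subtype.ext (U.act_eq_zero_of_mem_core hf x.2))

/-- The core of weight `m` as a module over `B̄_m`. -/
def coreMod (m : ℕ) (M : B.Mod) : ModuleCat.{u} (B.Bar m) :=
  let _ : Module (B.Bar m) (U.core m M) :=
    { smul := fun r x => U.coreAct m M r x
      one_smul := fun x => Subtype.ext (M.one_act x.1)
      mul_smul := fun r s x => by
        obtain ⟨r, rfl⟩ := B.barHom_surjective m r
        obtain ⟨s, rfl⟩ := B.barHom_surjective m s
        exact Subtype.ext (M.mul_act r s x.1)
      smul_zero := fun r => map_zero (U.coreAct m M r)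
      smul_add := fun r => map_add (U.coreAct m M r)
      add_smul := fun r s x => by
        change U.coreAct m M (r + s) x = _
        rw [map_add]
        rfl
      zero_smul := fun x => by
        change U.coreAct m M 0 x = _
        rw [map_zero]
        rfl }
  ModuleCat.of (B.Bar m) (U.core m M)

/-- The inclusion of the core. -/
def coreι (m : ℕ) (M : B.Mod) : U.coreMod m M →+ M.X m := (U.core m M).subtype.toAddMonoidHom

theorem coreι_smul (f : B.E m m) (x : U.coreMod m M) :
    U.coreι m M (B.barHom m f • x) = M.act f (U.coreι m M x) := rfl

theorem coreι_injective : Function.Injective (U.coreι m M) := Subtype.val_injective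

theorem coreι_mem (x : U.coreMod m M) : U.coreι m M x ∈ U.core m M := Subtype.property x

theorem exists_coreι {x : M.X m} (hx : x ∈ U.core m M) : ∃ y, U.coreι m M y = x := ⟨⟨x, hx⟩, rfl⟩

/-- A homomorphism into the core. -/
theorem exists_hom_coreMod (j : V →+ M.X m)
    (hj : ∀ (f : B.E m m) v, j (B.barHom m f • v) = M.act f (j v)) (hmem : ∀ v, j v ∈ U.core m M) :
    ∃ φ : V ⟶ U.coreMod m M, ∀ v, U.coreι m M (φ.hom v) = j v :=
  ⟨ModuleCat.ofHom (Y := U.coreMod m M)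
    { toFun := fun v => (⟨j v, hmem v⟩ : U.core m M)
      map_add' := fun v w => Subtype.ext (map_add j v w)
      map_smul' := fun r v => by
        obtain ⟨r, rfl⟩ := B.barHom_surjective m r
        exact Subtype.ext (hj r v) }, fun _ => rfl⟩

/-- A homomorphism out of a standard module is determined by a homomorphism into the core. -/
theorem exists_std_desc (φ : V ⟶ U.coreMod m M) :
    ∃ ψ : (B.std m).obj V ⟶ M, ∀ (b : ℕ) (f : B.E b m) (v : V),
      Mod.Hom.app ψ b (stdGen V f v) = M.act f (U.coreι m M (φ.hom v)) := by
  let j : V →ₗ[𝕜] M.X m :=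
    { toFun := fun v => U.coreι m M (φ.hom v)
      map_add' := fun v w => by rw [map_add, map_add]
      map_smul' := fun c v => by
        rw [← algebraMap_smul (B.Bar m) c v, map_smul, ← (B.barHom m).commutes, coreι_smul,
          Algebra.algebraMap_eq_smul_one, map_smul, LinearMap.smul_apply, one_def, M.one_act]
        rfl }
  have hj : ∀ v, j v ∈ U.core m M := fun v => U.coreι_mem _
  have hsmul : ∀ (f : B.E m m) v, j (B.barHom m f • v) = M.act f (j v) := fun f v => by
    change U.coreι m M (φ.hom _) = _
    rw [map_smul, coreι_smul]
    rfl
  -- The action descends to the truncation because the ideal divided out annihilates the core.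
  let T : ∀ b, (B.trunc m).E b m →ₗ[𝕜] V →ₗ[𝕜] M.X b := fun b =>
    Submodule.liftQ _ (M.act.compl₂ j)
      (fun f hf => LinearMap.ext fun v => U.act_eq_zero_of_mem_core hf (hj v))
  have hT : ∀ b (f : B.E b m) v, T b (B.toTrunc m b m f) v = M.act f (j v) := fun _ _ _ => rfl
  let ψ : ∀ b, ((B.std m).obj V).X b →ₗ[𝕜] M.X b := fun b =>
    Submodule.liftQ _ (TensorProduct.lift (T b)) (by
      refine Submodule.span_le.2 ?_
      rintro _ ⟨x, r, v, rfl⟩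
      obtain ⟨x, rfl⟩ := Submodule.Quotient.mk_surjective _ x
      obtain ⟨r, rfl⟩ := B.barHom_surjective m r
      rw [SetLike.mem_coe, LinearMap.mem_ker, map_sub, sub_eq_zero]
      refine (hT b (B.mul x r) v).trans ?_
      refine Eq.trans ?_ (hT b x _).symm
      rw [hsmul, M.mul_act])
  have hψ : ∀ b (f : B.E b m) v, ψ b (stdGen V f v) = M.act f (j v) := fun _ _ _ => rfl
  refine ⟨⟨ψ, fun {a b} f x => ?_⟩, hψ⟩
  refine std_induction (p := fun x => ψ a (((B.std m).obj V).act f x) = M.act f (ψ b x))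
    (fun g v => ?_) (fun x y hx hy => ?_) x
  · rw [act_stdGen, hψ, hψ, M.mul_act]
  · rw [map_add, map_add, hx, hy, map_add, map_add]

end Modules

end LayerUnits

end LUAlg

namespace LUAlg

variable {𝕜 : Type u} [Field 𝕜] {B : LUAlg 𝕜}

/-! ### The standardization functor is an equivalence -/

/-- The inclusion of a summand of `Δ(V)`. -/
noncomputable def deltaι (V : B.BarMod) (m : ℕ) : (B.std m).obj (V m) ⟶ B.Delta.obj V where
  app a := DirectSum.lof 𝕜 ℕ (fun m => ((B.std m).obj (V m)).X a) m
  comm f x := (DirectSum.lmap_lof (fun m => ((B.std m).obj (V m)).act f) m x).symm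

theorem deltaι_injective (V : B.BarMod) (m a : ℕ) :
    Function.Injective (Mod.Hom.app (deltaι V m) a) :=
  DirectSum.of_injective (β := fun m => ((B.std m).obj (V m)).X a) m

theorem deltaι_map {V W : B.BarMod} (φ : V ⟶ W) (m : ℕ) :
    deltaι V m ≫ B.Delta.map φ = (B.std m).map (φ m) ≫ deltaι W m :=
  Mod.hom_ext fun a x => DirectSum.lmap_lof (fun m => Mod.Hom.app ((B.std m).map (φ m)) a) m x

theorem delta_induction {V : B.BarMod} {a : ℕ} {p : (B.Delta.obj V).X a → Prop} (h0 : p 0)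
    (hι : ∀ m x, p (Mod.Hom.app (deltaι V m) a x)) (hadd : ∀ x y, p x → p y → p (x + y))
    (x : (B.Delta.obj V).X a) : p x :=
  DirectSum.induction_on (β := fun m => ((B.std m).obj (V m)).X a) x h0 hι hadd

theorem delta_hom_ext {V : B.BarMod} {M : B.Mod} {φ ψ : B.Delta.obj V ⟶ M}
    (h : ∀ m, deltaι V m ≫ φ = deltaι V m ≫ ψ) : φ = ψ := by
  refine Mod.hom_ext fun a x => delta_induction
    (p := fun x => Mod.Hom.app φ a x = Mod.Hom.app ψ a x) ?_ (fun m x => ?_) (fun x y hx hy => ?_) x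
  · rw [map_zero, map_zero]
  · exact congrArg (fun χ => Mod.Hom.app χ a x) (h m)
  · rw [map_add, map_add, hx, hy]

/-- Homomorphisms out of `Δ(V)`. -/
theorem exists_delta_desc {V : B.BarMod} {M : B.Mod} (φ : ∀ m, (B.std m).obj (V m) ⟶ M) :
    ∃ ψ : B.Delta.obj V ⟶ M, ∀ m, deltaι V m ≫ ψ = φ m := by
  let ψ : ∀ a, (B.Delta.obj V).X a →ₗ[𝕜] M.X a := fun a =>
    DirectSum.toModule 𝕜 ℕ (M.X a) fun m => Mod.Hom.app (φ m) a
  have hψ : ∀ a m x, ψ a (Mod.Hom.app (deltaι V m) a x) = Mod.Hom.app (φ m) a x :=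
    fun a m x =>
    DirectSum.toModule_lof (M := fun m => ((B.std m).obj (V m)).X a) 𝕜 m x
  refine ⟨⟨ψ, fun {a b} f x => ?_⟩, fun m => Mod.hom_ext fun a x => hψ a m x⟩
  refine delta_induction (p := fun x => ψ a ((B.Delta.obj V).act f x) = M.act f (ψ b x)) ?_
    (fun m x => ?_) (fun x y hx hy => ?_) x
  · simp only [map_zero]
  · rw [← Mod.Hom.comm, hψ, hψ, Mod.Hom.comm]
  · simp only [map_add, hx, hy]

instance delta_faithful : B.Delta.Faithful where
  map_injective {V W φ ψ} h := by
    funext m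
    apply ModuleCat.hom_ext
    refine LinearMap.ext fun v => ?_
    apply stdGen_one_injective
    apply deltaι_injective W m m
    have h₁ := congrArg (fun χ => Mod.Hom.app χ m (stdGen (V m) (B.one m) v)) (deltaι_map φ m)
    have h₂ := congrArg (fun χ => Mod.Hom.app χ m (stdGen (V m) (B.one m) v)) (deltaι_map ψ m)
    rw [h] at h₁
    exact h₁.symm.trans h₂

namespace LayerUnits

theorem act_layer_deltaι (U : B.LayerUnits) {V : B.BarMod} {m t a : ℕ} (x : ((B.std m).obj (V m)).X a) :
    (B.Delta.obj V).act (U.layer t a) (Mod.Hom.app (deltaι V m) a x) =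
      if t = m then Mod.Hom.app (deltaι V m) a x else 0 := by
  rw [← Mod.Hom.comm]
  split_ifs with h
  · subst h
    rw [U.act_layer_std]
  · rw [U.act_layer_std_of_ne h, map_zero]

/-- The layer `t` of `Δ(V)` is the summand indexed by `t`. -/
theorem exists_act_layer_delta (U : B.LayerUnits) {V : B.BarMod} {t a : ℕ} (x : (B.Delta.obj V).X a) :
    ∃ y, (B.Delta.obj V).act (U.layer t a) x = Mod.Hom.app (deltaι V t) a y := by
  refine delta_induction (p := fun x => ∃ y, (B.Delta.obj V).act (U.layer t a) x =
    Mod.Hom.app (deltaι V t) a y) ⟨0, by simp only [map_zero]⟩ (fun m x => ?_) ?_ x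
  · rw [U.act_layer_deltaι]
    split_ifs with h
    · subst h
      exact ⟨x, rfl⟩
    · exact ⟨0, (map_zero _).symm⟩
  · rintro x y ⟨x', hx⟩ ⟨y', hy⟩
    exact ⟨x' + y', by rw [map_add, hx, hy, map_add]⟩

/-- A homomorphism commutes with the layer idempotents, so it respects the summands. In weight `m`
the summand `m` consists of the elements `1 ⊗ w`, and `w` is unique, which makes the induced map
linear over `B̄_m`. -/
theorem delta_full (U : B.LayerUnits) : B.Delta.Full where
  map_surjective {V W} θ := by
    have h : ∀ m (v : V m), ∃ w : W m,
        Mod.Hom.app θ m (Mod.Hom.app (deltaι V m) m (stdGen (V m) (B.one m) v)) =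
          Mod.Hom.app (deltaι W m) m (stdGen (W m) (B.one m) w) := by
      intro m v
      obtain ⟨y, hy⟩ := U.exists_act_layer_delta (t := m)
        (Mod.Hom.app θ m (Mod.Hom.app (deltaι V m) m (stdGen (V m) (B.one m) v)))
      rw [← Mod.Hom.comm, U.act_layer_deltaι, if_pos rfl] at hy
      obtain ⟨w, rfl⟩ := exists_stdGen_one y
      exact ⟨w, hy⟩
    choose φ hφ using h
    have hinj : ∀ m, Function.Injective fun w : W m =>
        Mod.Hom.app (deltaι W m) m (stdGen (W m) (B.one m) w) := fun m =>
      (deltaι_injective W m m).comp stdGen_one_injective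
    let Φ : V ⟶ W := fun m => ModuleCat.ofHom
      { toFun := φ m
        map_add' := fun v w => hinj m (by
          simp only [← hφ, stdGen_add, map_add])
        map_smul' := fun r v => hinj m (by
          obtain ⟨r, rfl⟩ := B.barHom_surjective m r
          simp only [RingHom.id_apply]
          rw [← hφ, ← stdGen_mul, ← stdGen_mul, B.one_mul, ← act_stdGen_one, ← act_stdGen_one r,
            Mod.Hom.comm, Mod.Hom.comm, Mod.Hom.comm, hφ]) }
    refine ⟨Φ, delta_hom_ext fun m => ?_⟩
    rw [deltaι_map]
    exact std_hom_ext fun v => (hφ m v).symm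

/-- The module is recovered from its cores by the map `f ⊗ v ↦ f v`. It is injective because a layer
is detected by its part of weight `t`, and surjective because it is generated by that part. -/
theorem delta_essSurj (U : B.LayerUnits) : B.Delta.EssSurj where
  mem_essImage M := by
    choose ε hε using fun m => U.exists_std_desc (𝟙 (U.coreMod m M))
    obtain ⟨E, hE⟩ := exists_delta_desc (V := fun m => U.coreMod m M) ε
    have hE' : ∀ a m x, Mod.Hom.app E a (Mod.Hom.app (deltaι (fun m => U.coreMod m M) m) a x) =
        Mod.Hom.app (ε m) a x := fun a m x => congrArg (fun χ => Mod.Hom.app χ a x) (hE m)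
    refine ⟨fun m => U.coreMod m M, ⟨@asIso _ _ _ _ E (Mod.isIso_of_bijective E fun a => ⟨?_, ?_⟩)⟩⟩
    · rw [← LinearMap.ker_eq_bot, LinearMap.ker_eq_bot']
      intro x hx
      rw [← U.sum_act_layer x]
      refine Finset.sum_eq_zero fun t _ => ?_
      obtain ⟨y, hy⟩ := U.exists_act_layer_delta (t := t) x
      have hy0 : Mod.Hom.app (ε t) a y = 0 := by
        rw [← hE', ← hy, Mod.Hom.comm, hx, map_zero]
      suffices y = 0 by rw [hy, this, map_zero]
      refine U.std_eq_zero y fun g => ?_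
      obtain ⟨v, hv⟩ := exists_stdGen_one (((B.std t).obj (U.coreMod t M)).act g y)
      have hv0 : U.coreι t M v = 0 := by
        have h := hε t t (B.one t) v
        rw [← hv, Mod.Hom.comm, hy0, map_zero, M.one_act] at h
        exact h.symm
      rw [hv, U.coreι_injective (hv0.trans (map_zero _).symm), stdGen_zero]
    · rw [← LinearMap.range_eq_top, eq_top_iff]
      intro x _
      rw [← U.sum_act_layer x]
      refine sum_mem fun t _ => U.act_layer_mem x fun f g => ?_
      obtain ⟨v, hv⟩ := U.exists_coreι (U.act_layer_mem_core (M.act g x))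
      refine ⟨Mod.Hom.app (deltaι (fun m => U.coreMod m M) t) a (stdGen _ f v), ?_⟩
      rw [hE', hε, ← hv]
      rfl

theorem delta_isEquivalence (U : B.LayerUnits) : B.Delta.IsEquivalence :=
  have := U.delta_full
  have := U.delta_essSurj
  { }

/-! ### Standardizations of projective covers -/

variable {m : ℕ} {V W : ModuleCat.{u} (B.Bar m)}

/-- Lifting out of a standard module amounts to lifting `V` into the cores, and taking cores
preserves epimorphisms because the core is cut out by an idempotent. -/
theorem std_projective (U : B.LayerUnits) [Projective V] : Projective ((B.std m).obj V) where
  factors {X Y} f e he := by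
    obtain ⟨φ, hφ⟩ := U.exists_hom_coreMod (V := V) (M := Y)
      (AddMonoidHom.mk' (fun v => Mod.Hom.app f m (stdGen V (B.one m) v))
        (fun v w => by rw [stdGen_add, map_add]))
      (fun r v => by
        change Mod.Hom.app f m _ = Y.act r (Mod.Hom.app f m _)
        rw [← stdGen_mul, B.one_mul, ← act_stdGen_one, Mod.Hom.comm])
      (fun v => U.app_mem_core f (U.stdGen_one_mem_core v))
    obtain ⟨ψ, hψ⟩ := U.exists_hom_coreMod (V := U.coreMod m X) (M := Y)
      ((Mod.Hom.app e m).toAddMonoidHom.comp (U.coreι m X))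
      (fun r v => Mod.Hom.comm e r (U.coreι m X v))
      (fun v => U.app_mem_core e (U.coreι_mem v))
    have : Epi ψ := by
      rw [ModuleCat.epi_iff_surjective]
      intro x
      obtain ⟨y, hy⟩ := Mod.surjective_of_epi e m (U.coreι m Y x)
      obtain ⟨z, hz⟩ := U.exists_coreι (U.act_layer_mem_core y)
      -- An arbitrary preimage need not lie in the core; its projection by the layer idempotent
      -- does, and has the same image.
      refine ⟨z, U.coreι_injective ((hψ z).trans ?_)⟩
      change Mod.Hom.app e m (U.coreι m X z) = _
      rw [hz, Mod.Hom.comm, hy, U.act_layer_of_mem_core (U.coreι_mem x)]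
    obtain ⟨g, hg⟩ := U.exists_std_desc (Projective.factorThru φ ψ)
    refine ⟨g, std_hom_ext fun v => ?_⟩
    rw [Mod.comp_app, hg, X.one_act]
    refine (hψ _).symm.trans (Eq.trans ?_ (hφ v))
    rw [← ModuleCat.comp_apply, Projective.factorThru_comp]

/-- The preimage in `V` of the part of weight `m` of a submodule of its standard module. -/
noncomputable def stdComap (V : ModuleCat.{u} (B.Bar m))
    (Z : Submodule 𝕜 (((B.std m).obj V).X m))
    (hZ : ∀ (f : B.E m m), ∀ x ∈ Z, ((B.std m).obj V).act f x ∈ Z) : Submodule (B.Bar m) V where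
  carrier := {v | stdGen V (B.one m) v ∈ Z}
  add_mem' {v w} hv hw := by
    change stdGen V (B.one m) (v + w) ∈ Z
    rw [stdGen_add]
    exact add_mem hv hw
  zero_mem' := by
    change stdGen V (B.one m) 0 ∈ Z
    rw [stdGen_zero]
    exact zero_mem _
  smul_mem' r v hv := by
    obtain ⟨r, rfl⟩ := B.barHom_surjective m r
    change stdGen V (B.one m) (B.barHom m r • v) ∈ Z
    rw [← stdGen_mul, B.one_mul, ← act_stdGen_one]
    exact hZ r _ hv

theorem range_stable {M N : B.Mod} (φ : M ⟶ N) (f : B.E m m) :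
    ∀ x ∈ LinearMap.range (Mod.Hom.app φ m), N.act f x ∈ LinearMap.range (Mod.Hom.app φ m) := by
  rintro _ ⟨x, rfl⟩
  exact ⟨M.act f x, Mod.Hom.comm φ f x⟩

theorem ker_stable {M N : B.Mod} (φ : M ⟶ N) (f : B.E m m) :
    ∀ x ∈ LinearMap.ker (Mod.Hom.app φ m), M.act f x ∈ LinearMap.ker (Mod.Hom.app φ m) := by
  intro x hx
  rw [LinearMap.mem_ker, Mod.Hom.comm, LinearMap.mem_ker.1 hx, map_zero]

/-- A standard module is generated by the elements `1 ⊗ v`. -/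
theorem surjective_of_stdComap_range {M : B.Mod} (φ : M ⟶ (B.std m).obj V)
    (h : stdComap V _ (range_stable φ) = ⊤) (a : ℕ) : Function.Surjective (Mod.Hom.app φ a) := by
  intro x
  refine std_induction (p := fun x => ∃ y, Mod.Hom.app φ a y = x) (fun f v => ?_) ?_ x
  · have hv : v ∈ stdComap V _ (range_stable φ) := h ▸ Submodule.mem_top
    obtain ⟨y, hy⟩ := hv
    exact ⟨M.act f y, by rw [Mod.Hom.comm, hy, act_stdGen_one]⟩
  · rintro _ _ ⟨y, rfl⟩ ⟨z, rfl⟩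
    exact ⟨y + z, map_add _ _ _⟩

/-- A submodule is controlled by its part of weight `m`, a `B̄_m`-submodule of `V`: if that part is
everything the submodule generates the module, and if it is zero the submodule vanishes by
`std_eq_zero`. -/
theorem std_simple (U : B.LayerUnits) [Simple V] : Simple ((B.std m).obj V) where
  mono_isIso_iff_nonzero {Y} f _ := by
    have hV : IsSimpleModule (B.Bar m) V := (simple_iff_isSimpleModule' _).1 inferInstance
    constructor
    · rintro hf rfl
      have := IsSimpleModule.nontrivial (B.Bar m) V
      obtain ⟨v, hv⟩ := exists_ne (0 : V)
      obtain ⟨y, hy⟩ := (Mod.bijective_of_isIso (0 : Y ⟶ (B.std m).obj V) m).2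
        (stdGen V (B.one m) v)
      exact hv (stdGen_one_injective (hy.symm.trans (stdGen_zero _).symm))
    · intro hf
      refine Mod.isIso_of_bijective f fun a => ⟨Mod.injective_of_mono f a, ?_⟩
      refine surjective_of_stdComap_range f ?_ a
      refine (eq_bot_or_eq_top _).resolve_left fun hbot => hf (Mod.hom_ext fun a y => ?_)
      refine U.std_eq_zero _ fun g => ?_
      rw [← Mod.Hom.comm]
      obtain ⟨v, hv⟩ := exists_stdGen_one (Mod.Hom.app f m (Y.act g y))
      have hmem : v ∈ stdComap V _ (range_stable f) := ⟨_, hv⟩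
      rw [hbot, Submodule.mem_bot] at hmem
      rw [hv, hmem, stdGen_zero]

theorem std_map_epi (p : V ⟶ W) [Epi p] : Epi ((B.std m).map p) := by
  refine Mod.epi_of_surjective _ fun a x => ?_
  refine std_induction (p := fun x => ∃ y, Mod.Hom.app ((B.std m).map p) a y = x)
    (fun f w => ?_) ?_ x
  · obtain ⟨v, rfl⟩ := (ModuleCat.epi_iff_surjective p).1 inferInstance w
    exact ⟨stdGen V f v, rfl⟩
  · rintro _ _ ⟨y, rfl⟩ ⟨z, rfl⟩
    exact ⟨y + z, map_add _ _ _⟩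

/-- A submodule which is mapped onto the target of a projective cover is everything. -/
theorem _root_.WeaklyTriangular.IsProjectiveCover.eq_top {R : Type u} [Ring R]
    {V W : ModuleCat.{u} R} {p : V ⟶ W} (hp : IsProjectiveCover p) (Z : Submodule R V)
    (h : ∀ w : W, ∃ v ∈ Z, p.hom v = w) : Z = ⊤ := by
  have hepi : Epi (ModuleCat.ofHom Z.subtype) := by
    refine hp.2.2 _ ?_
    rw [ModuleCat.epi_iff_surjective]
    intro w
    obtain ⟨v, hv, rfl⟩ := h w
    exact ⟨⟨v, hv⟩, rfl⟩
  rw [ModuleCat.epi_iff_range_eq_top] at hepi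
  rw [← hepi]
  exact Z.range_subtype.symm

/-- If `g` maps onto the quotient, the part of its range in `V` maps onto `W`. Essentiality of `p`
makes this part all of `V`, and `V` generates the standard module. -/
theorem std_isProjectiveCover (U : B.LayerUnits) {p : V ⟶ W} (hp : IsProjectiveCover p) :
    IsProjectiveCover ((B.std m).map p) := by
  have := hp.1
  have := hp.2.1
  refine ⟨U.std_projective, std_map_epi p, fun Y g hg => ?_⟩
  refine Mod.epi_of_surjective g (surjective_of_stdComap_range g ?_)
  refine hp.eq_top _ fun w => ?_
  obtain ⟨y, hy⟩ := Mod.surjective_of_epi (g ≫ (B.std m).map p) m (stdGen W (B.one m) w)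
  obtain ⟨v, hv⟩ := exists_stdGen_one (Mod.Hom.app g m y)
  refine ⟨v, ⟨y, hv⟩, stdGen_one_injective ?_⟩
  rw [← map_stdGen, ← hv]
  exact hy

theorem std_isUniqueIrreducibleQuotient (U : B.LayerUnits) [Simple W] {p : V ⟶ W}
    (hp : IsProjectiveCover p) : IsUniqueIrreducibleQuotient ((B.std m).map p) := by
  have := hp.2.1
  have hepi := std_map_epi p
  refine ⟨U.std_simple, hepi, fun L' q hL' hq => ?_⟩
  have hW : IsSimpleModule (B.Bar m) W := (simple_iff_isSimpleModule' _).1 inferInstance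
  -- the kernel of `q` is mapped to zero
  have hker : ∀ v ∈ stdComap V _ (ker_stable q), p.hom v = 0 := by
    have hmap : (stdComap V _ (ker_stable q)).map p.hom = ⊥ := by
      -- The image in the simple module `W` is zero or everything; in the second case essentiality
      -- of `p` puts all of `V` into the kernel, so that `q = 0`, which is impossible for an
      -- epimorphism onto a simple module.
      refine (eq_bot_or_eq_top _).resolve_right fun htop => ?_
      have h := hp.eq_top (stdComap V _ (ker_stable q)) fun w => by
        have hw : w ∈ (stdComap V _ (ker_stable q)).map p.hom := htop ▸ Submodule.mem_top
        exact hw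
      have hq0 : q = 0 := std_hom_ext fun v => by
        have hv : v ∈ stdComap V _ (ker_stable q) := h ▸ Submodule.mem_top
        exact hv
      apply Simple.not_isZero L'
      rw [Limits.IsZero.iff_id_eq_zero, ← cancel_epi q, hq0, Limits.zero_comp, Limits.zero_comp]
    intro v hv
    rw [← Submodule.mem_bot (B.Bar m), ← hmap]
    exact ⟨v, hv, rfl⟩
  -- The inclusion of kernels is known in weight `m`, and standard modules are detected there. The
  -- factorization is an epimorphism between simple modules, hence invertible.
  obtain ⟨χ, hχ⟩ := Mod.exists_factor q ((B.std m).map p) fun a x hx => by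
    refine U.std_eq_zero _ fun g => ?_
    rw [← Mod.Hom.comm]
    obtain ⟨v, hv⟩ := exists_stdGen_one (((B.std m).obj V).act g x)
    have hmem : v ∈ stdComap V _ (ker_stable q) := by
      change Mod.Hom.app q m (stdGen V (B.one m) v) = 0
      rw [← hv, Mod.Hom.comm, hx, map_zero]
    rw [hv, map_stdGen, hker v hmem, stdGen_zero]
  have hχepi : Epi χ := epi_of_epi_fac hχ
  have hχ0 : χ ≠ 0 := by
    rintro rfl
    have hs := U.std_simple (V := W)
    apply Simple.not_isZero ((B.std m).obj W)
    rw [Limits.IsZero.iff_id_eq_zero, ← cancel_epi ((B.std m).map p), ← hχ, Limits.comp_zero,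
      Limits.zero_comp, Limits.zero_comp]
  have hiso : IsIso χ := Mod.isIso_of_bijective χ fun a =>
    ⟨Mod.injective_of_simple χ hχ0 a, Mod.surjective_of_epi χ a⟩
  refine ⟨(asIso χ).symm, ?_⟩
  rw [← hχ]
  simp

end LayerUnits

end LUAlg

end WeaklyTriangular

/-! ### The main theorem. -/

theorem theorem5p9 {𝕜 : Type u} [Field 𝕜] [IsAlgClosed 𝕜]
    -- the strict monoidal category, the right tensor ideal and the algebra `A = K.alg`
    (kind : Kind) (P : StrandCategory 𝕜) (G : P.Generators) (hG : G.Relations kind)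
    (K : P.RightTensorIdeal) (hfin : ∀ a b : ℕ, FiniteDimensional 𝕜 (K.alg.E a b))
    -- the weakly triangular decomposition
    (W : WeaklyTriangularDecomposition K.alg)
    -- bases of the decomposition that are compatible with adding a strand
    (S : W.Bases) (D : ∀ m : ℕ, Set (K.alg.E (m + 1) (m + 1))) (hS : K.CompatibleBases G S D)
    -- the monoidal contravariant involution
    (σ : K.Involution)
    -- cellular bases of the algebras `Ā_m`
    (C : ∀ m : ℕ, CellularBasis.{u, v} (σ.onBar m))
    -- `i`-induction and `i`-restriction of cell modules: multiplicity-free cell filtrations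
    (addable : ∀ m : ℕ, 𝕜 → (C m).Λ → Set (C (m + 1)).Λ)
    (removable : ∀ m : ℕ, 𝕜 → (C (m + 1)).Λ → Set (C m).Λ)
    (hind : ∀ (m : ℕ) (i : 𝕜) (l : (C m).Λ) (V : ModuleCat.{u} (K.Abar m)),
      (C m).IsCellModule l V →
        (C (m + 1)).HasMultiplicityFreeCellFiltration (K.iInd G m i V) (addable m i l))
    (hres : ∀ (m : ℕ) (i : 𝕜) (l : (C (m + 1)).Λ) (V : ModuleCat.{u} (K.Abar (m + 1))),
      (C (m + 1)).IsCellModule l V →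
        (C m).HasMultiplicityFreeCellFiltration (K.iRes G m i V) (removable m i l))
    -- reciprocity of the two branching rules
    (hrec : ∀ (m : ℕ) (i : 𝕜) (l : (C m).Λ) (k : (C (m + 1)).Λ),
      k ∈ addable m i l ↔ l ∈ removable m i k)
    -- `Ā_0 = 𝕜`
    (hzero : Function.Bijective (algebraMap 𝕜 (K.Abar 0)))
    -- self-duality of the simple `Ā_m`-modules and of their projective covers
    (hdual : ∀ (m : ℕ) (L Q : ModuleCat.{u} (K.Abar m)) (p : Q ⟶ L), Simple L →
      IsProjectiveCover p → IsSelfDual (σ.onBar m) Q ∧ IsSelfDual (σ.onBar m) L)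
    (hI : K.I₀ G ∩ sharp kind '' K.I₀ G = ∅) :
    -- `Δ(μ)` is the projective cover of its unique irreducible quotient `L(μ)`
    (∀ (m : ℕ) (L Q : ModuleCat.{u} (K.Abar m)) (p : Q ⟶ L), Simple L → IsProjectiveCover p →
      ∃ (N : K.alg.Mod) (q : (K.alg.std m).obj Q ⟶ N),
        IsUniqueIrreducibleQuotient q ∧ IsProjectiveCover q) ∧
    -- the standardization functor is an equivalence
    K.alg.Delta.IsEquivalence := by
  obtain ⟨U⟩ := StrandCategory.RightTensorIdeal.nonempty_layerUnits hG hfin hS σ hI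
  -- The irreducible quotient of the standard module is the standardization of the simple
  -- `Ā_m`-module itself.
  exact ⟨fun m L Q p hL hp => ⟨(K.alg.std m).obj L, (K.alg.std m).map p,
    U.std_isUniqueIrreducibleQuotient hp, U.std_isProjectiveCover hp⟩, U.delta_isEquivalence⟩
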